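/- Let $\mathbb{Z}_4=\mathbb{Z}/4\mathbb{Z}$. A (proper) arithmetic progression of length $3$ in $\mathbb{Z}_4^n$ is a triple of pairwise distinct elements $a,\ a+d,\ a+2d$ with $a,d\in\mathbb{Z}_4^n$. Let $r_3(\mathbb{Z}_4^n)$ denote the maximal size of a subset of $\mathbb{Z}_4^n$ that contains no arithmetic progression of length $3$. Then \[ r_3(\mathbb{Z}_4^1)=2,\quad r_3(\mathbb{Z}_4^2)=6,\quad r_3(\mathbb{Z}_4^3)=16,\quad r_3(\mathbb{Z}_4^4)=42,\quad r_3(\mathbb{Z}_4^5)=124. \] -/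

import Mathlib

/-- `x 0, …, x (k-1)` is a (proper) arithmetic progression of length `k`:
consecutive terms have a common difference, and all `k` terms are distinct. -/
def IsProperAP {G : Type*} [AddCommGroup G] (k : ℕ) (x : Fin k → G) : Prop :=
  Function.Injective x ∧ ∃ a d : G, ∀ i : Fin k, x i = a + (i : ℕ) • d

/-- `S` contains no proper arithmetic progression of length `k`. -/
def IsAPFree {G : Type*} [AddCommGroup G] (k : ℕ) (S : Finset G) : Prop :=
  ¬ ∃ x : Fin k → G, IsProperAP k x ∧ ∀ i, x i ∈ S

open Classical in
/-- `r_k(ℤ_m^n)`: the largest size of a subset of `ℤ_m^n` without a proper arithmetic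
progression of length `k`. -/
noncomputable def maxAPFree (k m n : ℕ) [NeZero m] : ℕ :=
  (Finset.univ.filter fun S : Finset (Fin n → ZMod m) => IsAPFree k S).sup Finset.card

set_option linter.unusedSectionVars false

namespace ProgressionFree

open Finset

section Weight

open scoped Classical

/-! ### Spreads, averaging over translates, and restriction to cosets -/

section Basic

variable {V : Type*} [AddCommGroup V] [Module (ZMod 2) V]

/-! Write a vector of ℤ_4^n as c + 2a with binary digit vectors c and a. For x = c + 2a and z = c' +
2b, the equation x + z = 2y says that c = c' and that y has first digits c + a + b; the second
digits of y are free. So a set is progression-free exactly when, over each first digit c in its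
projection S, distinct second digits a, b satisfy c + a + b ∉ S. Hence r_3 is the maximum of `weight
S` over S ⊆ F_2^n, where c contributes the independence number of the Cayley graph on F_2^n with
generators c + s, s ∈ S, s ≠ c.

These independence numbers are bounded by averaging: a density bound for a small configuration holds
in the whole space. If some functional is 1 on all generators at c (`IsIsolated`), then S without c
lies in one hyperplane coset, and the weight is bounded by recursion on the dimension. Otherwise a
short odd set of generators sums to zero: three of them give density at most 1/4, five give a
Clebsch graph and density at most 5/16. This settles n ≤ 3, and n = 4 when |S| ≤ 10. For larger S in
dimension 4, a spread of size 3 at c makes c a sum of three points outside S, and the few triples in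
the complement bound the number of such c.

In dimension 5 the remaining case has |S| ≥ 16, all spread numbers at most 8, and at least six
points of S in every hyperplane coset. A spread of size 5 at c makes c good (`IsGood`) or yields a
rigid pattern (`hasPattern_of_spread`). With a pattern, some hyperplane coset meets S in exactly six
known points, and the other coset is handled by the dimension 4 estimates
(`weight_le_of_hasPattern`). Without one, the weight is at most 4(|S| + number of good points), and
`card_add_card_isGood_le` bounds the bracket by 31.

The lower bounds take S to be a Hamming ball of radius 1 or 2 and linear codes as fibres. -/

theorem char_two (x : V) : x + x = 0 := ZModModule.add_self x

theorem add_cancel_two (x y : V) : x + (x + y) = y := by rw [← add_assoc, char_two, zero_add]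

theorem add_ne_zero_of_ne {x y : V} (h : x ≠ y) : x + y ≠ 0 := fun h0 =>
  h (by grind [char_two y])

/-- `A` is a spread at `c` relative to `S`: no translate of `c` by the sum of two distinct
elements of `A` lies in `S`. -/
def IsSpread (S : Finset V) (c : V) (A : Finset V) : Prop :=
  ∀ ⦃a⦄, a ∈ A → ∀ ⦃b⦄, b ∈ A → a ≠ b → c + a + b ∉ S

/-- The largest size of a spread at `c`. -/
noncomputable def spreadNumber (S : Finset V) (c : V) : ℕ :=
  sSup {k | ∃ A, IsSpread S c A ∧ #A = k}

/-- The sum of the spread numbers over all points of `S`. -/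
noncomputable def weight (S : Finset V) : ℕ := ∑ c ∈ S, spreadNumber S c

theorem spreadNumber_le {S : Finset V} {c : V} {k : ℕ} (h : ∀ A, IsSpread S c A → #A ≤ k) :
    spreadNumber S c ≤ k := by
  refine csSup_le (s := {k | ∃ A, IsSpread S c A ∧ #A = k}) ⟨0, ∅, by simp [IsSpread], rfl⟩ ?_
  rintro _ ⟨A, hA, rfl⟩
  exact h A hA

theorem IsSpread.translate {S : Finset V} {c : V} {A : Finset V} (h : IsSpread S c A) (t : V) :
    IsSpread S c (A.image (t + ·)) := by
  intro a ha b hb hab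
  obtain ⟨a, ha, rfl⟩ := mem_image.1 ha
  obtain ⟨b, hb, rfl⟩ := mem_image.1 hb
  have := h ‹a ∈ A› ‹b ∈ A› (fun h => hab (by rw [h]))
  grind [char_two t]

variable [Finite V]

theorem exists_isSpread (S : Finset V) (c : V) : ∃ A, IsSpread S c A ∧ #A = spreadNumber S c := by
  have := Fintype.ofFinite V
  refine Nat.sSup_mem (s := {k | ∃ A, IsSpread S c A ∧ #A = k}) ⟨0, ∅, by simp [IsSpread], rfl⟩
    ⟨Fintype.card V, ?_⟩
  rintro _ ⟨A, -, rfl⟩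
  exact card_le_univ A

theorem IsSpread.card_le {S : Finset V} {c : V} {A : Finset V} (h : IsSpread S c A) :
    #A ≤ spreadNumber S c := by
  have := Fintype.ofFinite V
  refine le_csSup ⟨Fintype.card V, ?_⟩ ⟨A, h, rfl⟩
  rintro _ ⟨A, -, rfl⟩
  exact card_le_univ A

/-- Double counting of the pairs (v, i) with v + p i ∈ A. A packing bound for translates of a small
configuration becomes a density bound for A. -/
theorem card_mul_card_le {ι : Type*} [Fintype ι] (p : ι → V) (A : Finset V) (k : ℕ)
    (h : ∀ v, #{i | v + p i ∈ A} ≤ k) : Fintype.card ι * #A ≤ Nat.card V * k := by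
  have := Fintype.ofFinite V
  calc Fintype.card ι * #A = ∑ i : ι, #{v | v + p i ∈ A} := by
        rw [Finset.sum_congr rfl (fun i _ => ?_), sum_const, smul_eq_mul, card_univ]
        rw [← card_map (Equiv.addRight (p i)).toEmbedding]
        congr 1
        ext v
        simp
    _ = ∑ v : V, #{i | v + p i ∈ A} := by
        simp only [card_filter]
        exact sum_comm
    _ ≤ ∑ v : V, k := sum_le_sum fun v _ => h v
    _ = Nat.card V * k := by simp [Nat.card_eq_fintype_card]

theorem spreadNumber_le_card (S : Finset V) (c : V) : spreadNumber S c ≤ Nat.card V := by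
  have := Fintype.ofFinite V
  refine spreadNumber_le fun A _ => ?_
  rw [Nat.card_eq_fintype_card]
  exact card_le_univ A

/-- If the elements `p i` have pairwise differences along which `c` moves inside `S`, then
spreads at `c` have density at most `1 / |ι|`. -/
theorem card_mul_spreadNumber_le {ι : Type*} [Fintype ι] (p : ι → V) {S : Finset V} {c : V}
    (h : ∀ i j, i ≠ j → p i ≠ p j ∧ c + p i + p j ∈ S) :
    Fintype.card ι * spreadNumber S c ≤ Nat.card V := by
  obtain ⟨A, hA, hcard⟩ := exists_isSpread S c
  rw [← hcard, ← mul_one (Nat.card V)]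
  refine card_mul_card_le p A 1 fun v => card_le_one.2 fun i hi j hj => ?_
  by_contra hij
  obtain ⟨hne, hmem⟩ := h i j hij
  refine hA (mem_filter.1 hi).2 (mem_filter.1 hj).2 (by simpa using hne) ?_
  grind [char_two v]

theorem two_mul_spreadNumber_le {S : Finset V} {c d : V} (hd : d ∈ S) (hcd : c ≠ d) :
    2 * spreadNumber S c ≤ Nat.card V := by
  have := card_mul_spreadNumber_le ![0, c + d] (S := S) (c := c) (by
    have := add_ne_zero_of_ne hcd
    intro i j hij
    fin_cases i <;> fin_cases j <;> simp [add_cancel_two, this, this.symm, hd] at hij ⊢)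
  simpa using this

theorem four_mul_spreadNumber_le {S : Finset V} {c a b : V} (ha : a ≠ 0) (hb : b ≠ 0)
    (hab : a ≠ b) (hSa : c + a ∈ S) (hSb : c + b ∈ S) (hSab : c + a + b ∈ S) :
    4 * spreadNumber S c ≤ Nat.card V := by
  have h0 := add_ne_zero_of_ne hab
  have := card_mul_spreadNumber_le ![0, a, b, a + b] (S := S) (c := c) (by
    have h1 : c + b + a ∈ S := by grind
    have h2 : c + a + (a + b) ∈ S := by grind [char_two a]
    have h3 : c + b + (a + b) ∈ S := by grind [char_two b]
    have h4 : c + (a + b) + a ∈ S := by grind [char_two a]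
    have h5 : c + (a + b) + b ∈ S := by grind [char_two b]
    have h6 : c + (a + b) ∈ S := by grind
    intro i j hij
    fin_cases i <;> fin_cases j <;>
      first
      | exact absurd rfl hij
      | simp [*, hab.symm, ha.symm, hb.symm, h0.symm])
  simpa using this

/-- The part of `S` in the coset `y + W`, as a subset of `W`. -/
noncomputable def slice (W : Submodule (ZMod 2) V) (y : V) (S : Finset V) : Finset W :=
  S.preimage (fun w : W => y + w) (fun _ _ _ _ h => Subtype.ext (add_left_cancel h))

@[simp] theorem mem_slice {W : Submodule (ZMod 2) V} {y : V} {S : Finset V} {w : W} :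
    w ∈ slice W y S ↔ y + (w : V) ∈ S :=
  mem_preimage

/-- Each translate of a spread, cut down to W, is a spread for the slice; averaging over translates
compares the densities. -/
theorem card_mul_spreadNumber_slice_le (W : Submodule (ZMod 2) V) (y : V) (S : Finset V) (w : W) :
    Nat.card W * spreadNumber S (y + w) ≤ Nat.card V * spreadNumber (slice W y S) w := by
  have := Fintype.ofFinite W
  obtain ⟨A, hA, hcard⟩ := exists_isSpread S (y + w)
  rw [← hcard, Nat.card_eq_fintype_card]
  refine card_mul_card_le (fun u : W => (u : V)) A _ fun v => IsSpread.card_le ?_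
  intro a ha b hb hab hmem
  refine hA (mem_filter.1 ha).2 (mem_filter.1 hb).2 (by simpa using hab) ?_
  have h := mem_slice.1 hmem
  push_cast at h
  grind [char_two v]

theorem sum_slice (W : Submodule (ZMod 2) V) (y : V) (S : Finset V) (f : V → ℕ) :
    ∑ c ∈ S with y + c ∈ W, f c = ∑ w ∈ slice W y S, f (y + w) := by
  symm
  refine sum_bij (fun w _ => y + (w : V)) ?_ ?_ ?_ ?_
  · intro w hw
    simpa [mem_filter, add_cancel_two] using hw
  · intro a _ b _ h
    exact Subtype.ext (add_left_cancel h)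
  · intro c hc
    obtain ⟨hc, hW⟩ := mem_filter.1 hc
    exact ⟨⟨y + c, hW⟩, by simpa [add_cancel_two] using hc, by simp [add_cancel_two]⟩
  · simp

theorem card_slice (W : Submodule (ZMod 2) V) (y : V) (S : Finset V) :
    #(slice W y S) = #{c ∈ S | y + c ∈ W} := by
  simpa using (sum_slice W y S (fun _ => 1)).symm

theorem sum_spreadNumber_coset_le (W : Submodule (ZMod 2) V) (hW : Nat.card V = 2 * Nat.card W)
    (y : V) (S : Finset V) :
    ∑ c ∈ S with y + c ∈ W, spreadNumber S c ≤ 2 * weight (slice W y S) := by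
  rw [sum_slice, weight, mul_sum]
  refine sum_le_sum fun w _ => ?_
  have h := card_mul_spreadNumber_slice_le W y S w
  have h0 : 0 < Nat.card W := Nat.card_pos
  rw [hW] at h
  refine Nat.le_of_mul_le_mul_left (c := Nat.card W) ?_ h0
  linarith

end Basic

/-! ### Odd circuits among the generators: hyperplane, plane or Clebsch graph -/

section Circuits

theorem card_le_two_of_pentagon (s : Finset (Fin 5)) (h : ∀ i, ¬ (i ∈ s ∧ i + 1 ∈ s)) :
    #s ≤ 2 := by
  revert s
  decide

theorem card_inter_pentagon_le {α : Type*} [DecidableEq α] (x : Fin 5 → α) (B : Finset α)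
    (h : ∀ i, ¬ (x i ∈ B ∧ x (i + 1) ∈ B)) : #(B ∩ univ.image x) ≤ 2 := by
  have h1 : B ∩ univ.image x ⊆ ({i | x i ∈ B} : Finset (Fin 5)).image x := by
    intro y hy
    simp only [mem_inter, mem_image, mem_univ, true_and, mem_filter] at hy ⊢
    obtain ⟨hy, i, rfl⟩ := hy
    exact ⟨i, hy, rfl⟩
  exact (card_le_card h1).trans (card_image_le.trans
    (card_le_two_of_pentagon _ (by simpa using h)))

/-- The independence number of the Clebsch graph is at most `5`. -/
theorem clebsch_card_le (B : Finset (Fin 4 → ZMod 2))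
    (h : ∀ x ∈ B, ∀ y ∈ B, hammingNorm (x + y) ≠ 1 ∧ hammingNorm (x + y) ≠ 4) : #B ≤ 5 := by
  wlog h0 : 0 ∈ B generalizing B
  · obtain rfl | ⟨z, hz⟩ := B.eq_empty_or_nonempty
    · simp
    have := this (B.image (z + ·)) (by
      intro x hx y hy
      obtain ⟨x, hx, rfl⟩ := mem_image.1 hx
      obtain ⟨y, hy, rfl⟩ := mem_image.1 hy
      convert h _ ‹x ∈ B› _ ‹y ∈ B› using 3 <;> grind [char_two z]) (mem_image.2 ⟨z, hz, char_two
          z⟩)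
    rwa [card_image_of_injective _ (add_right_injective z)] at this
  -- The ten non-neighbours of 0, the vectors of weight two and three, form a Petersen graph; `p`
  -- and `q` are disjoint 5-cycles covering it. Each meets `B` at most twice, so #B ≤ 1 + 2 + 2.
  let p : Fin 5 → Fin 4 → ZMod 2 :=
    ![![1, 1, 0, 0], ![0, 0, 1, 1], ![0, 1, 1, 1], ![0, 1, 1, 0], ![1, 1, 1, 0]]
  let q : Fin 5 → Fin 4 → ZMod 2 :=
    ![![1, 0, 1, 0], ![0, 1, 0, 1], ![1, 1, 0, 1], ![1, 0, 0, 1], ![1, 0, 1, 1]]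
  have hp : ∀ i, hammingNorm (p i + p (i + 1)) = 1 ∨ hammingNorm (p i + p (i + 1)) = 4 := by
    decide
  have hq : ∀ i, hammingNorm (q i + q (i + 1)) = 1 ∨ hammingNorm (q i + q (i + 1)) = 4 := by
    decide
  have hpq : ∀ x : Fin 4 → ZMod 2, hammingNorm (0 + x) = 1 ∨ hammingNorm (0 + x) = 4 ∨ x = 0 ∨
      (∃ i, p i = x) ∨ ∃ i, q i = x := by
    decide
  have hB : B ⊆ {0} ∪ (B ∩ univ.image p ∪ B ∩ univ.image q) := by
    intro x hx
    have := h 0 h0 x hx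
    have := hpq x
    simp only [mem_union, mem_singleton, mem_inter, mem_image, mem_univ, true_and]
    tauto
  have h1 := card_inter_pentagon_le p B fun i hi => by
    have := h _ hi.1 _ hi.2
    have := hp i
    tauto
  have h2 := card_inter_pentagon_le q B fun i hi => by
    have := h _ hi.1 _ hi.2
    have := hq i
    tauto
  have h3 := card_le_card hB
  have h4 := card_union_le {0} (B ∩ univ.image p ∪ B ∩ univ.image q)
  have h5 := card_union_le (B ∩ univ.image p) (B ∩ univ.image q)
  rw [card_singleton] at h4
  omega

variable {V : Type*} [AddCommGroup V] [Module (ZMod 2) V]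

theorem smul_cases (e : ZMod 2) (v : V) : e = 0 ∧ e • v = 0 ∨ e = 1 ∧ e • v = v := by
  fin_cases e
  · exact .inl ⟨rfl, zero_smul _ v⟩
  · exact .inr ⟨rfl, one_smul _ v⟩

theorem sum_symmDiff_two (X Y : Finset V) :
    ∑ z ∈ symmDiff X Y, z = ∑ z ∈ X, z + ∑ z ∈ Y, z := by
  rw [symmDiff_def, sup_eq_union, sum_union (disjoint_sdiff_sdiff),
    ← sum_inter_add_sum_sdiff X Y, ← sum_inter_add_sum_sdiff Y X, inter_comm Y X]
  grind [char_two (∑ z ∈ X ∩ Y, z)]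

/-- Lift each r to (r, 1). If (0, 1) is outside the span, a functional separating it gives the first
case; otherwise the coefficients of (0, 1) single out an odd zero-sum subset. -/
theorem exists_functional_or_odd (R : Finset V) :
    (∃ l : V →ₗ[ZMod 2] ZMod 2, ∀ r ∈ R, l r = 1) ∨ ∃ Z ⊆ R, Odd #Z ∧ ∑ z ∈ Z, z = 0 := by
  by_cases h : ((0 : V), (1 : ZMod 2)) ∈
      Submodule.span (ZMod 2) ((fun r : V => (r, (1 : ZMod 2))) '' (R : Set V))
  · right
    obtain ⟨f, hf⟩ := (Submodule.mem_span_image_finset_iff_exists_fun' _).1 h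
    refine ⟨{r ∈ R | f r = 1}, filter_subset _ _, ?_, ?_⟩
    · have h2 : (∑ i ∈ R, f i • (i, (1 : ZMod 2))).2 = 1 := congrArg Prod.snd hf
      rw [← ZMod.natCast_eq_one_iff_odd, natCast_card_filter]
      refine Eq.trans ?_ h2
      rw [Prod.snd_sum]
      refine sum_congr rfl fun r _ => ?_
      rcases smul_cases (f r) (1 : ZMod 2) with ⟨h1, h3⟩ | ⟨h1, h3⟩ <;> simp [h1]
    · have h2 : (∑ i ∈ R, f i • (i, (1 : ZMod 2))).1 = 0 := congrArg Prod.fst hf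
      rw [Prod.fst_sum] at h2
      rw [← h2, sum_filter]
      refine sum_congr rfl fun r _ => ?_
      rcases smul_cases (f r) r with ⟨h1, h3⟩ | ⟨h1, h3⟩ <;> simp [h1]
  · left
    obtain ⟨f, hf, hker⟩ := Submodule.exists_le_ker_of_notMem h
    refine ⟨f ∘ₗ LinearMap.inl _ _ _, fun r hr => ?_⟩
    have h1 : f (r, 1) = 0 := hker (Submodule.subset_span ⟨r, hr, rfl⟩)
    have h2 : f (r, 1) = f (r, 0) + f (0, 1) := by rw [← map_add]; simp
    have h3 : ∀ e e' : ZMod 2, e ≠ 0 → e' + e = 0 → e' = 1 := by decide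
    exact h3 _ _ hf (h2 ▸ h1)

variable [Finite V]

/-- Take an odd zero-sum Z of least size and drop one point. The subset sums of the rest are
distinct: a coincidence makes a symmetric difference sum to zero, and it or its complement in Z is a
smaller odd zero-sum set. -/
theorem exists_functional_or_small_odd (R : Finset V) :
    (∃ l : V →ₗ[ZMod 2] ZMod 2, ∀ r ∈ R, l r = 1) ∨
      ∃ Z ⊆ R, Odd #Z ∧ ∑ z ∈ Z, z = 0 ∧ 2 ^ (#Z - 1) ≤ Nat.card V := by
  refine (exists_functional_or_odd R).imp_right fun hZ => ?_
  have hex : ∃ m, ∃ Z ⊆ R, Odd #Z ∧ ∑ z ∈ Z, z = 0 ∧ #Z = m := by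
    obtain ⟨Z, h1, h2, h3⟩ := hZ
    exact ⟨_, Z, h1, h2, h3, rfl⟩
  obtain ⟨Z, hZR, hodd, hsum, hcard⟩ := Nat.find_spec hex
  have hmin : ∀ Z' ⊆ R, Odd #Z' → ∑ z ∈ Z', z = 0 → #Z ≤ #Z' := fun Z' h1 h2 h3 =>
    hcard ▸ Nat.find_min' hex ⟨Z', h1, h2, h3, rfl⟩
  refine ⟨Z, hZR, hodd, hsum, ?_⟩
  have := Fintype.ofFinite V
  obtain ⟨z₀, hz₀⟩ : Z.Nonempty := card_pos.1 hodd.pos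
  by_contra! hlt
  rw [Nat.card_eq_fintype_card, ← card_univ, ← card_erase_of_mem hz₀, ← card_powerset] at hlt
  obtain ⟨X, hX, Y, hY, hXY, heq⟩ := exists_ne_map_eq_of_card_lt_of_maps_to hlt
    (f := fun X => ∑ z ∈ X, z) (fun _ _ => mem_univ _)
  have hsub : symmDiff X Y ⊆ Z.erase z₀ := by
    rw [mem_powerset] at hX hY
    exact symmDiff_le_sup.trans (union_subset hX hY)
  have hsubZ := hsub.trans (erase_subset z₀ Z)
  have hzero : ∑ z ∈ symmDiff X Y, z = 0 := by
    rw [sum_symmDiff_two]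
    rw [heq, char_two]
  have hne : 0 < #(symmDiff X Y) := card_pos.2 (by
    rw [nonempty_iff_ne_empty]
    exact fun h => hXY (symmDiff_eq_bot.1 h))
  have hlt' : #(symmDiff X Y) < #Z := by
    have := card_le_card hsub
    rw [card_erase_of_mem hz₀] at this
    have := hodd.pos
    omega
  rcases Nat.even_or_odd #(symmDiff X Y) with he | ho
  · have hs := sum_sdiff (f := fun z => z) hsubZ
    have hc := card_sdiff_of_subset hsubZ
    have := hmin (Z \ symmDiff X Y) (sdiff_subset.trans hZR)
      (hc ▸ Nat.Odd.sub_even hlt'.le hodd he) (by simpa [hzero, hsum] using hs)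
    omega
  · exact absurd (hmin _ (hsubZ.trans hZR) ho hzero) (by omega)

/-- Every other point of `S` lies on the affine hyperplane `l x = l c + 1`. -/
def IsIsolated (S : Finset V) (c : V) : Prop :=
  ∃ l : V →ₗ[ZMod 2] ZMod 2, ∀ s ∈ S, s ≠ c → l s = l c + 1

/-- `S` contains an affine plane through `c`. -/
def HasPlane (S : Finset V) (c : V) : Prop :=
  ∃ a b, a ≠ 0 ∧ b ≠ 0 ∧ a ≠ b ∧ c + a ∈ S ∧ c + b ∈ S ∧ c + a + b ∈ S

theorem isIsolated_or_hasPlane_or_pentagon (S : Finset V) (c : V)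
    (hV : Nat.card V ≤ 32) :
    IsIsolated S c ∨ HasPlane S c ∨ (16 ≤ Nat.card V ∧
      ∃ t : Fin 5 → V, (∀ i, t i ≠ 0 ∧ c + t i ∈ S) ∧ ∑ i, t i = 0) := by
  rcases exists_functional_or_small_odd ((S.erase c).image (c + ·)) with
    ⟨l, hl⟩ | ⟨Z, hZ, hodd, hsum, hcard⟩
  · left
    refine ⟨l, fun s hs hsc => ?_⟩
    have := hl (c + s) (mem_image_of_mem _ (mem_erase.2 ⟨hsc, hs⟩))
    rw [map_add] at this
    have h : ∀ x y : ZMod 2, x + y = 1 → y = x + 1 := by decide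
    exact h _ _ this
  right
  have hR : ∀ z ∈ Z, z ≠ 0 ∧ c + z ∈ S := by
    intro z hz
    obtain ⟨s, hs, rfl⟩ := mem_image.1 (hZ hz)
    obtain ⟨h1, h2⟩ := mem_erase.1 hs
    exact ⟨add_ne_zero_of_ne h1.symm, by rwa [add_cancel_two]⟩
  -- 2 ^ (#Z - 1) ≤ 32 < 2 ^ 6; as #Z is odd, only 1, 3 and 5 remain.
  have hle : #Z - 1 < 6 := (Nat.pow_lt_pow_iff_right (a := 2) (by norm_num)).1 (by omega)
  obtain h1 | h3 | h5 : #Z = 1 ∨ #Z = 3 ∨ #Z = 5 := by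
    obtain ⟨k, hk⟩ := hodd
    omega
  · obtain ⟨z, rfl⟩ := card_eq_one.1 h1
    exact absurd (by simpa using hsum) (hR z (by simp)).1
  · left
    obtain ⟨a, b, d, hab, had, hbd, rfl⟩ := card_eq_three.1 h3
    rw [sum_insert (by simp [hab, had]), sum_insert (by simp [hbd]), sum_singleton] at hsum
    obtain ⟨ha, ha'⟩ := hR a (by simp)
    obtain ⟨hb, hb'⟩ := hR b (by simp)
    obtain ⟨-, hd⟩ := hR d (by simp)
    refine ⟨a, b, ha, hb, hab, ha', hb', ?_⟩
    grind [char_two a, char_two b, char_two d]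
  · right
    refine ⟨by rw [h5] at hcard; omega, fun i => (Z.equivFinOfCardEq h5).symm i,
      fun i => hR _ (Subtype.mem _), ?_⟩
    rw [Equiv.sum_comp (Z.equivFinOfCardEq h5).symm (fun z => (z : V)), ← hsum]
    exact sum_coe_sort Z (fun z => z)

theorem HasPlane.four_mul_le {S : Finset V} {c : V} (h : HasPlane S c) :
    4 * spreadNumber S c ≤ Nat.card V := by
  obtain ⟨a, b, ha, hb, hab, h1, h2, h3⟩ := h
  exact four_mul_spreadNumber_le ha hb hab h1 h2 h3

/-- Map the basis of F_2^4 to the first four t i; the all-ones vector then goes to the fifth. Each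
translate of this map pulls a spread back to an independent set of the Clebsch graph. -/
theorem sixteen_mul_spreadNumber_le {S : Finset V} {c : V} {t : Fin 5 → V}
    (ht : ∀ i, t i ≠ 0 ∧ c + t i ∈ S) (hsum : ∑ i, t i = 0) :
    16 * spreadNumber S c ≤ Nat.card V * 5 := by
  obtain ⟨A, hA, hcard⟩ := exists_isSpread S c
  let f : (Fin 4 → ZMod 2) →ₗ[ZMod 2] V :=
    Fintype.linearCombination (ZMod 2) (fun i : Fin 4 => t i.castSucc)
  have hf : ∀ x, hammingNorm x = 1 ∨ hammingNorm x = 4 → ∃ i, f x = t i := by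
    intro x hx
    have hx' : ∀ x : Fin 4 → ZMod 2, hammingNorm x = 1 ∨ hammingNorm x = 4 →
        (∃ i, x = Pi.single i 1) ∨ x = 1 := by decide
    rcases hx' x hx with ⟨i, rfl⟩ | rfl
    · exact ⟨i.castSucc, by simp [f, Fintype.linearCombination_apply_single]⟩
    · refine ⟨Fin.last 4, ?_⟩
      rw [Fin.sum_univ_castSucc] at hsum
      simp only [f, Fintype.linearCombination_apply, Pi.one_apply, one_smul]
      grind [char_two (t (Fin.last 4))]
  have := card_mul_card_le f A 5 fun v => clebsch_card_le _ fun x hx y hy => by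
    rw [← not_or]
    intro hxy
    obtain ⟨i, hi⟩ := hf _ hxy
    rw [map_add] at hi
    obtain ⟨h0, hS⟩ := ht i
    refine hA (mem_filter.1 hx).2 (mem_filter.1 hy).2 (fun h => h0 ?_) ?_
    · rw [← hi, add_left_cancel h, char_two]
    · rw [← hi] at hS
      grind [char_two v]
  simpa [hcard] using this

/-- Without planes through `c`, the set `S` itself, less `c`, is a spread at `c`. -/
theorem card_le_of_not_hasPlane {S : Finset V} {c : V} (hc : c ∈ S) (h : ¬ HasPlane S c) :
    #S ≤ spreadNumber S c + 1 := by
  have : IsSpread S c ((S.erase c).image (c + ·)) := by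
    intro a ha b hb hab hS
    obtain ⟨x, hx, rfl⟩ := mem_image.1 ha
    obtain ⟨y, hy, rfl⟩ := mem_image.1 hb
    rw [mem_erase] at hx hy
    exact h ⟨c + x, c + y, add_ne_zero_of_ne hx.1.symm, add_ne_zero_of_ne hy.1.symm, hab,
      by simp [add_cancel_two, hx], by simp [add_cancel_two, hy], hS⟩
  have := this.card_le
  rw [card_image_of_injective _ (add_right_injective c), card_erase_of_mem hc] at this
  omega

theorem card_ker_mul_two {l : V →ₗ[ZMod 2] ZMod 2} (hl : l ≠ 0) :
    Nat.card V = 2 * Nat.card (LinearMap.ker l) := by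
  have h1 := Submodule.card_eq_card_quotient_mul_card (LinearMap.ker l)
  have h2 := Nat.card_congr (l.quotKerEquivOfSurjective
    (LinearMap.surjective_of_ne_zero hl)).toEquiv
  rw [h2, Nat.card_zmod] at h1
  linarith

/-- The recursive step: c contributes at most half of V, and all other points lie in one coset of a
hyperplane, where passing to the slice costs a factor 2. -/
theorem IsIsolated.exists_weight_le {S : Finset V} {c : V} (hc : c ∈ S) (h : IsIsolated S c)
    (hS : 2 ≤ #S) : ∃ (W : Submodule (ZMod 2) V) (T : Finset W),
      Nat.card V = 2 * Nat.card W ∧ weight S ≤ Nat.card W + 2 * weight T ∧ #T + 1 = #S := by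
  obtain ⟨l, hl⟩ := h
  obtain ⟨d, hd, hdc⟩ := exists_mem_ne (s := S) (by omega) c
  have hl0 : l ≠ 0 := by
    rintro rfl
    simpa using hl d hd hdc
  have hW := card_ker_mul_two hl0
  have hfil : {s ∈ S | d + s ∈ LinearMap.ker l} = S.erase c := by
    ext s
    simp only [mem_filter, mem_erase, LinearMap.mem_ker, map_add, hl d hd hdc]
    refine ⟨fun ⟨hs, h⟩ => ⟨?_, hs⟩, fun ⟨hsc, hs⟩ => ⟨hs, ?_⟩⟩
    · rintro rfl
      generalize l s = e at h
      revert e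
      decide
    · rw [hl s hs hsc, char_two]
  refine ⟨LinearMap.ker l, slice _ d S, hW, ?_, ?_⟩
  · have h1 := sum_spreadNumber_coset_le _ hW d S
    have h2 := two_mul_spreadNumber_le hd hdc.symm
    rw [hfil] at h1
    rw [weight, ← add_sum_erase _ _ hc]
    omega
  · rw [card_slice, hfil, card_erase_of_mem hc]
    omega

end Circuits

/-! ### Weight bounds in dimensions one to four -/

section SmallDimension

variable {V : Type*} [AddCommGroup V] [Module (ZMod 2) V] [Finite V]

theorem weight_le_card_mul {S : Finset V} {k : ℕ} (h : ∀ c ∈ S, spreadNumber S c ≤ k) :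
    weight S ≤ #S * k := by
  have := sum_le_card_nsmul S _ k h
  rwa [smul_eq_mul] at this

theorem card_le_natCard (S : Finset V) : #S ≤ Nat.card V := by
  have := Fintype.ofFinite V
  rw [Nat.card_eq_fintype_card]
  exact card_le_univ S

theorem weight_le_of_card_le_one {S : Finset V} (hS : #S ≤ 1) : weight S ≤ Nat.card V := by
  have := weight_le_card_mul (S := S) fun c _ => spreadNumber_le_card S c
  nlinarith

theorem weight_le_two {S : Finset V} (hV : Nat.card V = 2) : weight S ≤ 2 := by
  rcases Nat.lt_or_ge 1 #S with hS | hS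
  · have := weight_le_card_mul (S := S) (k := 1) fun c _ => by
      obtain ⟨d, hd, hdc⟩ := exists_mem_ne hS c
      have := two_mul_spreadNumber_le hd hdc.symm
      omega
    have := card_le_natCard S
    omega
  · exact hV ▸ weight_le_of_card_le_one hS

theorem weight_le_six {S : Finset V} (hV : Nat.card V = 4) : weight S ≤ 6 := by
  rcases Nat.lt_or_ge 1 #S with hS | hS
  · by_cases h : ∃ c ∈ S, IsIsolated S c
    · obtain ⟨c, hc, h⟩ := h
      obtain ⟨W, T, hW, hle, -⟩ := h.exists_weight_le hc hS
      have := weight_le_two (S := T) (by omega)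
      omega
    · push Not at h
      have := weight_le_card_mul (S := S) (k := 1) fun c hc => by
        rcases isIsolated_or_hasPlane_or_pentagon S c (by omega) with h1 | h1 | h1
        · exact absurd h1 (h c hc)
        · have := h1.four_mul_le
          omega
        · omega
      have := card_le_natCard S
      omega
  · have := weight_le_of_card_le_one hS
    omega

theorem weight_le_sixteen {S : Finset V} (hV : Nat.card V = 8) : weight S ≤ 16 := by
  rcases Nat.lt_or_ge 1 #S with hS | hS
  · by_cases h : ∃ c ∈ S, IsIsolated S c
    · obtain ⟨c, hc, h⟩ := h
      obtain ⟨W, T, hW, hle, -⟩ := h.exists_weight_le hc hS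
      have := weight_le_six (S := T) (by omega)
      omega
    · push Not at h
      have := weight_le_card_mul (S := S) (k := 2) fun c hc => by
        rcases isIsolated_or_hasPlane_or_pentagon S c (by omega) with h1 | h1 | h1
        · exact absurd h1 (h c hc)
        · have := h1.four_mul_le
          omega
        · omega
      have := card_le_natCard S
      omega
  · have := weight_le_of_card_le_one hS
    omega

/-- The points of `S` that are sums of three distinct points outside `S`. -/
noncomputable def tripleSums (S : Finset V) : Finset V :=
  {c ∈ S | ∃ T : Finset V, #T = 3 ∧ Disjoint T S ∧ ∑ z ∈ T, z = c}

theorem mem_tripleSums {S : Finset V} {c : V} : c ∈ tripleSums S ↔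
    c ∈ S ∧ ∃ T : Finset V, #T = 3 ∧ Disjoint T S ∧ ∑ z ∈ T, z = c := mem_filter

theorem tripleSums_subset (S : Finset V) : tripleSums S ⊆ S := filter_subset _ _

/-- For distinct a, b, d in the spread, the excluded points c + a + b, c + a + d, c + b + d sum to c
in characteristic two. -/
theorem mem_tripleSums_of_spread {S A : Finset V} {c : V} (hc : c ∈ S) (hA : IsSpread S c A)
    (h3 : 2 < #A) : c ∈ tripleSums S := by
  obtain ⟨a, ha, b, hb, d, hd, hab, had, hbd⟩ := two_lt_card.1 h3
  refine mem_tripleSums.2 ⟨hc, {c + a + b, c + a + d, c + b + d}, ?_, ?_, ?_⟩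
  · rw [card_eq_three]
    exact ⟨_, _, _, by simpa using hbd,
      fun h => had (by grind), fun h => hab (by grind), rfl⟩
  · simp [hA ha hb hab, hA ha hd had, hA hb hd hbd]
  · rw [sum_insert, sum_insert, sum_singleton]
    · grind [char_two a, char_two b, char_two c, char_two d]
    · rw [mem_singleton]
      exact fun h => hab (by grind)
    · simp only [mem_insert, mem_singleton, not_or]
      exact ⟨fun h => hbd (by grind), fun h => had (by grind)⟩

theorem spreadNumber_le_of_sixteen {S : Finset V} (hV : Nat.card V = 16) {c : V} (hc : c ∈ S)
    (h : ¬ IsIsolated S c) : spreadNumber S c ≤ 4 ∨ spreadNumber S c ≤ 5 ∧ #S ≤ 6 := by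
  by_cases hp : HasPlane S c
  · left
    have := hp.four_mul_le
    omega
  · right
    have := card_le_of_not_hasPlane hc hp
    rcases isIsolated_or_hasPlane_or_pentagon S c (by omega) with h1 | h1 | ⟨-, t, ht, hs⟩
    · exact absurd h1 h
    · exact absurd h1 hp
    · have := sixteen_mul_spreadNumber_le ht hs
      omega

theorem not_isIsolated_of_card_lt {S : Finset V} (hS : Nat.card V + 2 < 2 * #S) {c : V}
    (hc : c ∈ S) : ¬ IsIsolated S c := by
  intro h
  have : 0 < Nat.card V := Nat.card_pos
  obtain ⟨W, T, hW, -, hT⟩ := h.exists_weight_le hc (by omega)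
  have := card_le_natCard T
  omega

/-- With at least ten points none is isolated and spread numbers are at most 4; beyond 2 they
require a triple sum. -/
theorem weight_le_tripleSums {S : Finset V} (hV : Nat.card V = 16) (hS : 9 < #S) :
    weight S ≤ 2 * #S + 2 * #(tripleSums S) := by
  have h : ∀ c ∈ S, spreadNumber S c ≤ 2 + if c ∈ tripleSums S then 2 else 0 := by
    intro c hc
    split_ifs with h
    · have := spreadNumber_le_of_sixteen hV hc (not_isIsolated_of_card_lt (by omega) hc)
      omega
    · obtain ⟨A, hA, hcard⟩ := exists_isSpread S c
      by_contra! hlt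
      exact h (mem_tripleSums_of_spread hc hA (by omega))
  refine (sum_le_sum h).trans ?_
  rw [sum_add_distrib, ← sum_filter, filter_mem_eq_inter,
    inter_eq_right.2 (tripleSums_subset S)]
  simp [mul_comm]

theorem card_tripleSums_le (S : Finset V) : #(tripleSums S) ≤ (Nat.card V - #S).choose 3 := by
  have := Fintype.ofFinite V
  rw [Nat.card_eq_fintype_card, ← card_compl, ← card_powersetCard]
  refine (card_le_card ?_).trans (card_image_le (f := fun T : Finset V => ∑ z ∈ T, z))
  intro c hc
  obtain ⟨-, T, hT, hd, hs⟩ := mem_tripleSums.1 hc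
  exact mem_image.2 ⟨T, mem_powersetCard.2 ⟨le_compl_iff_disjoint_right.2 hd, hT⟩, hs⟩

theorem weight_le_forty {S : Finset V} (hV : Nat.card V = 16) (hS : #S ≤ 10) : weight S ≤ 40 := by
  rcases Nat.lt_or_ge 1 #S with hS1 | hS1
  · by_cases h : ∃ c ∈ S, IsIsolated S c
    · obtain ⟨c, hc, h⟩ := h
      obtain ⟨W, T, hW, hle, -⟩ := h.exists_weight_le hc hS1
      have := weight_le_sixteen (S := T) (by omega)
      omega
    · push Not at h
      by_cases h5 : ∃ c ∈ S, 4 < spreadNumber S c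
      · have h6 : #S ≤ 6 := by
          obtain ⟨c, hc, h5⟩ := h5
          have := spreadNumber_le_of_sixteen hV hc (h c hc)
          omega
        have := weight_le_card_mul (S := S) (k := 5) fun c hc => by
          have := spreadNumber_le_of_sixteen hV hc (h c hc)
          omega
        omega
      · push Not at h5
        have := weight_le_card_mul h5
        omega
  · have := weight_le_of_card_le_one hS1
    omega

theorem weight_le_thirty_two {S : Finset V} (hV : Nat.card V = 16) (hS : 12 ≤ #S) :
    weight S ≤ 32 := by
  have h1 := weight_le_tripleSums (S := S) hV (by omega)
  have h2 := card_tripleSums_le S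
  have h3 := card_le_natCard S
  have h4 : #(tripleSums S) ≤ #S := card_le_card (tripleSums_subset S)
  rw [hV] at h2 h3
  interval_cases #S <;> simp only [Nat.reduceSub, Nat.choose] at h2 <;> omega

theorem weight_le_forty_two {S : Finset V} (hV : Nat.card V = 16) : weight S ≤ 42 := by
  rcases Nat.lt_or_ge #S 11 with hS | hS
  · have := weight_le_forty hV (by omega : #S ≤ 10)
    omega
  rcases Nat.lt_or_ge #S 12 with hS' | hS'
  -- The complement has five points, hence ten triples: 2·11 + 2·10 = 42.
  · have h1 := weight_le_tripleSums (S := S) hV (by omega)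
    have h2 := card_tripleSums_le S
    have : #S = 11 := by omega
    rw [hV, this] at h2
    simp [Nat.choose] at h2
    omega
  · have := weight_le_thirty_two hV hS'
    omega

/-- The complement of `S` contains the affine plane `p + {0, u, v, u + v}`. -/
def AvoidsPlane (S : Finset V) (p u v : V) : Prop :=
  u ≠ 0 ∧ v ≠ 0 ∧ u ≠ v ∧ p ∉ S ∧ p + u ∉ S ∧ p + v ∉ S ∧ p + u + v ∉ S

theorem AvoidsPlane.exists_finset {S : Finset V} {p u v : V} (h : AvoidsPlane S p u v) :
    ∃ P : Finset V, P = {p, p + u, p + v, p + u + v} ∧ #P = 4 ∧ Disjoint P S := by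
  obtain ⟨hu, hv, huv, h1, h2, h3, h4⟩ := h
  refine ⟨_, rfl, ?_, by simp [*]⟩
  have := add_ne_zero_of_ne huv
  rw [card_insert_of_notMem, card_eq_three.2 ⟨_, _, _, ?_, ?_, ?_, rfl⟩]
  · simpa using huv
  · simpa using hv
  · intro h
    exact hu (by grind)
  · simp [hu, hv, add_assoc, this]

/-- Three points of the avoided plane sum to its fourth point, which is not in S. So only 10 − 4
triples count, giving 22 + 2·6. -/
theorem weight_le_thirty_four {S : Finset V} (hV : Nat.card V = 16) (hS : #S = 11) {p u v : V}
    (h : AvoidsPlane S p u v) : weight S ≤ 34 := by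
  have := Fintype.ofFinite V
  obtain ⟨P, hP, hcard, hd⟩ := h.exists_finset
  have h1 := weight_le_tripleSums (S := S) hV (by omega)
  have hPS : P ⊆ Sᶜ := le_compl_iff_disjoint_right.2 hd
  have h2 : tripleSums S ⊆ (powersetCard 3 Sᶜ \ powersetCard 3 P).image
      (fun T : Finset V => ∑ z ∈ T, z) := by
    intro c hc
    obtain ⟨hc, T, hT, hdT, hs⟩ := mem_tripleSums.1 hc
    refine mem_image.2 ⟨T, mem_sdiff.2 ⟨mem_powersetCard.2
      ⟨le_compl_iff_disjoint_right.2 hdT, hT⟩, fun hTP => ?_⟩, hs⟩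
    have hTP := (mem_powersetCard.1 hTP).1
    obtain ⟨z, hz⟩ := card_eq_one.1 (by rw [card_sdiff_of_subset hTP]; omega : #(P \ T) = 1)
    have h3 := sum_sdiff (f := fun z => z) hTP
    have h4 : ∑ z ∈ P, z = 0 := by
      obtain ⟨hu, hv, huv, -⟩ := h
      have := add_ne_zero_of_ne huv
      rw [hP, sum_insert, sum_insert, sum_insert, sum_singleton]
      · grind [char_two p, char_two u, char_two v]
      · intro h
        exact hu (by grind [mem_singleton.1 h])
      · simp only [mem_insert, mem_singleton, not_or]
        exact ⟨by simpa using huv, fun h => hv (by grind)⟩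
      · simp [hu, hv, add_assoc, this]
    rw [hz, sum_singleton, hs, h4] at h3
    have hzc : z = c := by grind [char_two c]
    have hzP : z ∈ P := (mem_sdiff.1 (hz ▸ mem_singleton_self z)).1
    exact disjoint_left.1 hd hzP (hzc ▸ hc)
  have h3 := (card_le_card h2).trans card_image_le
  rw [card_sdiff_of_subset (powersetCard_mono hPS), card_powersetCard, card_powersetCard,
    hcard, card_compl, hS, ← Nat.card_eq_fintype_card, hV] at h3
  simp [Nat.choose] at h3
  omega

end SmallDimension

/-! ### Dimension five: good points and patterns -/

section DimensionFive

variable {V : Type*} [AddCommGroup V] [Module (ZMod 2) V] [Finite V]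

theorem weight_le_of_isIsolated {S : Finset V} (hV : Nat.card V = 32) {c : V} (hc : c ∈ S)
    (h : IsIsolated S c) : weight S ≤ 124 := by
  rcases Nat.lt_or_ge 1 #S with hS | hS
  · obtain ⟨W, T, hW, hle, -⟩ := h.exists_weight_le hc hS
    have := weight_le_forty_two (S := T) (by omega)
    omega
  · have := weight_le_of_card_le_one hS
    omega

theorem spreadNumber_le_eight {S : Finset V} (hV : Nat.card V = 32) {c : V} (hc : c ∈ S)
    (h : ¬ IsIsolated S c) : spreadNumber S c ≤ 8 ∨ spreadNumber S c ≤ 10 ∧ #S ≤ 11 := by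
  by_cases hp : HasPlane S c
  · left
    have := hp.four_mul_le
    omega
  · right
    have := card_le_of_not_hasPlane hc hp
    rcases isIsolated_or_hasPlane_or_pentagon S c (by omega) with h1 | h1 | ⟨-, t, ht, hs⟩
    · exact absurd h1 h
    · exact absurd h1 hp
    · have := sixteen_mul_spreadNumber_le ht hs
      omega

theorem add_mem_of_notMem {W : Submodule (ZMod 2) V} (hW : Nat.card V = 2 * Nat.card W) {a b : V}
    (ha : a ∉ W) (hb : b ∉ W) : a + b ∈ W := by
  have h : W.toAddSubgroup.index = 2 := by
    have h1 := W.toAddSubgroup.card_mul_index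
    have h2 : Nat.card W.toAddSubgroup = Nat.card W := rfl
    have h3 : 0 < Nat.card W := Nat.card_pos
    rw [h2, hW, mul_comm] at h1
    exact Nat.eq_of_mul_eq_mul_right h3 h1
  have := AddSubgroup.add_mem_iff_of_index_two h (a := a) (b := b)
  simp only [Submodule.mem_toAddSubgroup] at this
  tauto

theorem exists_coset {W : Submodule (ZMod 2) V} (hW : Nat.card V = 2 * Nat.card W) (y : V) :
    ∃ z, ∀ c, y + c ∉ W ↔ z + c ∈ W := by
  obtain ⟨x, hx⟩ : ∃ x, x ∉ W := by
    by_contra! h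
    have h1 : W = ⊤ := Submodule.eq_top_iff'.2 h
    have h2 : 0 < Nat.card V := Nat.card_pos
    have h3 : Nat.card (⊤ : Submodule (ZMod 2) V) = Nat.card V :=
      Nat.card_congr Submodule.topEquiv.toEquiv
    rw [h1, h3] at hW
    omega
  refine ⟨x + y, fun c => ⟨fun h => ?_, fun h h' => hx ?_⟩⟩
  · rw [add_assoc]
    exact add_mem_of_notMem hW hx h
  · have := W.add_mem h h'
    rwa [show x + y + c + (y + c) = x by grind [char_two y, char_two c]] at this

/-- At most 5·8 from the sparse coset and 2·42 from the other one. -/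
theorem weight_le_of_card_coset_le {S : Finset V} (hV : Nat.card V = 32)
    (h8 : ∀ c ∈ S, spreadNumber S c ≤ 8) {W : Submodule (ZMod 2) V} (hW : Nat.card W = 16) (y : V)
    (hS : #{c ∈ S | y + c ∈ W} ≤ 5) : weight S ≤ 124 := by
  have hVW : Nat.card V = 2 * Nat.card W := by omega
  obtain ⟨z, hz⟩ := exists_coset hVW y
  have h1 := sum_spreadNumber_coset_le W hVW z S
  have h2 := weight_le_forty_two (S := slice W z S) hW
  have h3 : ∑ c ∈ S with y + c ∈ W, spreadNumber S c ≤ _ := sum_le_card_nsmul _ _ 8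
    fun c hc => h8 c (mem_filter.1 hc).1
  rw [smul_eq_mul] at h3
  rw [weight, ← sum_filter_add_sum_filter_not S (fun c => y + c ∈ W)]
  simp only [hz]
  omega

/-- Some three-dimensional affine subspace meets `S` only in `c`. -/
def IsGood (S : Finset V) (c : V) : Prop :=
  ∃ F : Submodule (ZMod 2) V, Nat.card F = 8 ∧ ∀ u ∈ F, u ≠ 0 → c + u ∉ S

/-- The points `c + f x`, for `x` of Hamming weight one or two, lie outside `S`. -/
def HasPattern (S : Finset V) (c : V) : Prop :=
  ∃ f : (Fin 4 → ZMod 2) →ₗ[ZMod 2] V, Function.Injective f ∧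
    ∀ x, hammingNorm x = 1 ∨ hammingNorm x = 2 → c + f x ∉ S

theorem card_range_of_injective {k : ℕ} {f : (Fin k → ZMod 2) →ₗ[ZMod 2] V}
    (hf : Function.Injective f) : Nat.card (LinearMap.range f) = 2 ^ k := by
  rw [← Nat.card_congr (LinearEquiv.ofInjective f hf).toEquiv]
  simp

/-- The span of p + q, p + r, p + w has dimension three, and each of its nonzero elements is a
difference of two elements of A, because p + q + r is also in A. -/
theorem isGood_of_sum {S A : Finset V} {c p q r w : V} (hA : IsSpread S c A) (hp : p ∈ A)
    (hq : q ∈ A) (hr : r ∈ A) (hw : w ∈ A) (hpqr : p + q + r ∈ A) (hpq : p ≠ q) (hpr : p ≠ r)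
    (hqr : q ≠ r) (hpw : p ≠ w) (hqw : q ≠ w) (hrw : r ≠ w) (hne : p + q + r ≠ w) :
    IsGood S c := by
  let f : (Fin 3 → ZMod 2) →ₗ[ZMod 2] V :=
    Fintype.linearCombination (ZMod 2) ![p + q, p + r, p + w]
  have key : ∀ x, x = 0 ∨ ∃ a ∈ A, ∃ b ∈ A, a ≠ b ∧ f x = a + b := by
    intro x
    have hx : f x = x 0 • (p + q) + x 1 • (p + r) + x 2 • (p + w) := by
      simp [f, Fintype.linearCombination_apply, Fin.sum_univ_three]
    rcases smul_cases (x 0) (p + q) with ⟨h0, h0'⟩ | ⟨h0, h0'⟩ <;>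
    rcases smul_cases (x 1) (p + r) with ⟨h1, h1'⟩ | ⟨h1, h1'⟩ <;>
    rcases smul_cases (x 2) (p + w) with ⟨h2, h2'⟩ | ⟨h2, h2'⟩ <;>
    rw [h0', h1', h2'] at hx
    · left
      ext i
      fin_cases i <;> simp [h0, h1, h2]
    all_goals right
    · exact ⟨p, hp, w, hw, hpw, by grind⟩
    · exact ⟨p, hp, r, hr, hpr, by grind⟩
    · exact ⟨r, hr, w, hw, hrw, by grind [char_two p]⟩
    · exact ⟨p, hp, q, hq, hpq, by grind⟩
    · exact ⟨q, hq, w, hw, hqw, by grind [char_two p]⟩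
    · exact ⟨q, hq, r, hr, hqr, by grind [char_two p]⟩
    · exact ⟨p + q + r, hpqr, w, hw, hne, by grind [char_two p]⟩
  have hf : Function.Injective f := by
    rw [injective_iff_map_eq_zero]
    intro x hx
    rcases key x with h | ⟨a, -, b, -, hab, h⟩
    · exact h
    · exact absurd (h ▸ hx) (add_ne_zero_of_ne hab)
  refine ⟨LinearMap.range f, card_range_of_injective hf, ?_⟩
  rintro _ ⟨x, rfl⟩ hx
  rcases key x with rfl | ⟨a, ha, b, hb, hab, h⟩
  · exact absurd (map_zero f) hx
  · rw [h, ← add_assoc]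
    exact hA ha hb hab

theorem add_ne_of_not_isGood {S A : Finset V} {c : V} (hA : IsSpread S c A) (hc : ¬ IsGood S c)
    (h5 : 5 ≤ #A) {p q r w : V} (hp : p ∈ A) (hq : q ∈ A) (hr : r ∈ A) (hw : w ∈ A) (hpq : p ≠ q)
    (hpr : p ≠ r) (hqr : q ≠ r) : p + q + r ≠ w := by
  rintro rfl
  have h4 : #{p, q, r, p + q + r} < #A := lt_of_le_of_lt card_le_four h5
  obtain ⟨w, hwA, hw'⟩ := exists_mem_notMem_of_card_lt_card h4
  simp only [mem_insert, mem_singleton, not_or] at hw'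
  exact hc (isGood_of_sum hA hp hq hr hwA hw hpq hpr hqr (Ne.symm hw'.1) (Ne.symm hw'.2.1)
    (Ne.symm hw'.2.2.1) (Ne.symm hw'.2.2.2))

/-- At a point that is not good, no three of five spread elements sum to a fourth, so the four
differences from one of them are independent. Combinations of weight one or two are again
differences of spread elements. -/
theorem hasPattern_of_spread {S A : Finset V} {c : V} (hA : IsSpread S c A) (hc : ¬ IsGood S c)
    (h5 : 5 ≤ #A) : HasPattern S c := by
  obtain ⟨e⟩ : Nonempty (Fin 5 ↪ A) :=
    Function.Embedding.nonempty_of_card_le (by simpa using h5)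
  have he : ∀ {i j}, i ≠ j → (e i : V) ≠ e j := fun h h' => h (e.injective (Subtype.ext h'))
  have h4 : ∀ {i j k : Fin 5} (l : Fin 5), i ≠ j → i ≠ k → j ≠ k →
      (e i : V) + e j + e k ≠ e l := fun _ h1 h2 h3 =>
    add_ne_of_not_isGood hA hc h5 (e _).2 (e _).2 (e _).2 (e _).2 (he h1) (he h2) (he h3)
  let f : (Fin 4 → ZMod 2) →ₗ[ZMod 2] V :=
    Fintype.linearCombination (ZMod 2) (fun i => (e 0 : V) + e i.succ)
  have h1 : ∀ i, f (Pi.single i 1) = e 0 + e i.succ := fun i => by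
    simp [f, Fintype.linearCombination_apply_single]
  have hcases : ∀ x : Fin 4 → ZMod 2, x = 0 ∨ (∃ i, x = Pi.single i 1) ∨
      (∃ i j, i < j ∧ x = Pi.single i 1 + Pi.single j 1) ∨ (2 < hammingNorm x ∧
      ((∃ i j k, i < j ∧ j < k ∧ x = Pi.single i 1 + Pi.single j 1 + Pi.single k 1) ∨
      x = Pi.single 0 1 + Pi.single 1 1 + Pi.single 2 1 + Pi.single 3 1)) := by decide
  have key : ∀ x, x = 0 ∨ (∃ a ∈ A, ∃ b ∈ A, a ≠ b ∧ f x = a + b) ∨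
      2 < hammingNorm x ∧ f x ≠ 0 := by
    intro x
    rcases hcases x with h | ⟨i, rfl⟩ | ⟨i, j, hij, rfl⟩ | ⟨hx, h⟩
    · exact .inl h
    · exact .inr (.inl ⟨_, (e _).2, _, (e _).2, he (Fin.succ_ne_zero i).symm, h1 i⟩)
    · refine .inr (.inl ⟨_, (e i.succ).2, _, (e j.succ).2, he (by simpa using hij.ne), ?_⟩)
      rw [map_add, h1, h1]
      grind [char_two (e 0 : V)]
    · refine .inr (.inr ⟨hx, ?_⟩)
      rcases h with ⟨i, j, k, hij, hjk, rfl⟩ | rfl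
      · simp only [map_add, h1]
        have := h4 (i := i.succ) (j := j.succ) (k := k.succ) 0 (by simpa using hij.ne)
          (by simpa using (hij.trans hjk).ne) (by simpa using hjk.ne)
        intro h0
        exact this (by grind [char_two (e 0 : V)])
      · simp only [map_add, h1]
        have := h4 (i := Fin.succ 0) (j := Fin.succ 1) (k := Fin.succ 2) (Fin.succ 3)
          (by decide) (by decide) (by decide)
        intro h0
        exact this (by grind [char_two (e 0 : V), char_two (e (Fin.succ 3) : V)])
  refine ⟨f, ?_, fun x hx => ?_⟩
  · rw [injective_iff_map_eq_zero]
    intro x hx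
    rcases key x with h | ⟨a, -, b, -, hab, h⟩ | ⟨-, h⟩
    · exact h
    · exact absurd (h ▸ hx) (add_ne_zero_of_ne hab)
    · exact absurd hx h
  · rcases key x with rfl | ⟨a, ha, b, hb, hab, h⟩ | ⟨h, -⟩
    · simp at hx
    · rw [h, ← add_assoc]
      exact hA ha hb hab
    · omega

/-- Since c is not good, distinct pairs in the spread have distinct sums. Seven elements would give
21 points outside S, but at most 20 are available. -/
theorem spreadNumber_le_six {S : Finset V} (hV : Nat.card V = 32) (hS : 12 ≤ #S) {c : V}
    (hc : ¬ IsGood S c) : spreadNumber S c ≤ 6 := by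
  have := Fintype.ofFinite V
  obtain ⟨A, hA, hcard⟩ := exists_isSpread S c
  by_contra! h7
  have hinj : Set.InjOn (fun T : Finset V => c + ∑ z ∈ T, z) (powersetCard 2 A) := by
    intro T hT T' hT' h
    rw [mem_coe, mem_powersetCard] at hT hT'
    obtain ⟨p, q, hpq, rfl⟩ := card_eq_two.1 hT.2
    obtain ⟨r, w, hrw, rfl⟩ := card_eq_two.1 hT'.2
    simp only [insert_subset_iff, singleton_subset_iff] at hT hT'
    simp only [sum_pair hpq, sum_pair hrw, add_right_inj] at h
    by_cases hpr : p = r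
    · subst hpr
      rw [add_left_cancel h]
    by_cases hqr : q = r
    · subst hqr
      rw [add_comm p q] at h
      rw [add_left_cancel h, pair_comm]
    · exact absurd (by grind [char_two r]) (add_ne_of_not_isGood hA hc (by omega) hT.1.1 hT.1.2
        hT'.1.1 hT'.1.2 hpq hpr hqr)
  have hsub : (powersetCard 2 A).image (fun T : Finset V => c + ∑ z ∈ T, z) ⊆ Sᶜ := by
    intro y hy
    obtain ⟨T, hT, rfl⟩ := mem_image.1 hy
    rw [mem_powersetCard] at hT
    obtain ⟨p, q, hpq, rfl⟩ := card_eq_two.1 hT.2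
    simp only [insert_subset_iff, singleton_subset_iff] at hT
    rw [sum_pair hpq, ← add_assoc, mem_compl]
    exact hA hT.1.1 hT.1.2 hpq
  have h1 := card_le_card hsub
  rw [card_image_of_injOn hinj, card_powersetCard, card_compl, ← Nat.card_eq_fintype_card,
    hV] at h1
  have h2 : Nat.choose 7 2 ≤ (#A).choose 2 := Nat.choose_le_choose 2 (by omega)
  rw [show Nat.choose 7 2 = 21 from rfl] at h2
  omega

end DimensionFive

/-! ### The case of a pattern: six points in one hyperplane coset -/

section Pattern

variable {V : Type*} [AddCommGroup V] [Module (ZMod 2) V]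

/-- `P` is an affine plane. -/
def IsPlane (P : Finset V) : Prop :=
  #P = 4 ∧ ∀ x ∈ P, ∀ y ∈ P, ∀ z ∈ P, x + y + z ∈ P

theorem IsPlane.add_mem {P : Finset V} (h : IsPlane P) {x u : V} (hx : x ∈ P) (hu : x + u ∈ P)
    {y : V} (hy : y ∈ P) : y + u ∈ P := by
  have := h.2 y hy x hx (x + u) hu
  rwa [show y + x + (x + u) = y + u by grind [char_two x]] at this

theorem IsPlane.card_inter_le {P Q : Finset V} (hP : IsPlane P) (hQ : IsPlane Q) (h : P ≠ Q) :
    #(P ∩ Q) ≤ 2 := by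
  by_contra! h3
  obtain ⟨x, hx, y, hy, z, hz, hxy, hxz, hyz⟩ := two_lt_card.1 h3
  rw [mem_inter] at hx hy hz
  have h4 : #{x, y, z, x + y + z} = 4 := by
    rw [card_insert_of_notMem, card_eq_three.2 ⟨y, z, x + y + z, hyz, ?_, ?_, rfl⟩]
    · exact fun h => hxz (by grind [char_two z])
    · exact fun h => hxy (by grind [char_two y])
    · simp only [mem_insert, mem_singleton, not_or]
      exact ⟨hxy, hxz, fun h => hyz (by grind [char_two z])⟩
  have key : ∀ R : Finset V, IsPlane R → x ∈ R → y ∈ R → z ∈ R → {x, y, z, x + y + z} = R := by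
    intro R hR h1 h2 h3
    refine eq_of_subset_of_card_le ?_ (by rw [hR.1, h4])
    simp [insert_subset_iff, h1, h2, h3, hR.2 x h1 y h2 z h3]
  exact h ((key P hP hx.1 hy.1 hz.1).symm.trans (key Q hQ hx.2 hy.2 hz.2))

/-- All affine planes in a set of six points share a direction. -/
theorem exists_common_direction [Nontrivial V] {C : Finset V} (hC : #C ≤ 6) :
    ∃ u : V, u ≠ 0 ∧ ∀ P ⊆ C, IsPlane P → ∀ x ∈ P, x + u ∈ P := by
  by_cases h : ∃ P ⊆ C, IsPlane P
  swap
  · obtain ⟨u, hu⟩ := exists_ne (0 : V)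
    exact ⟨u, hu, fun P hP h' => absurd ⟨P, hP, h'⟩ h⟩
  obtain ⟨P, hPC, hP⟩ := h
  by_cases hQ : ∃ Q ⊆ C, IsPlane Q ∧ P ≠ Q
  · obtain ⟨Q, hQC, hQ, hPQ⟩ := hQ
    have h1 := hP.card_inter_le hQ hPQ
    have h2 := card_union_add_card_inter P Q
    rw [hP.1, hQ.1] at h2
    have hU : P ∪ Q = C := eq_of_subset_of_card_le (union_subset hPC hQC) (by omega)
    rw [hU] at h2
    obtain ⟨x, hx, y, hy, hxy⟩ := one_lt_card.1 (by omega : 1 < #(P ∩ Q))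
    rw [mem_inter] at hx hy
    have hd : ∀ z ∈ C, z + (x + y) ∈ C := by
      intro z hz
      rw [← hU, mem_union] at hz ⊢
      exact hz.imp (hP.add_mem hx.1 (by rw [add_cancel_two]; exact hy.1))
        (hQ.add_mem hx.2 (by rw [add_cancel_two]; exact hy.2))
    refine ⟨x + y, add_ne_zero_of_ne hxy, fun R hRC hR => ?_⟩
    by_contra! hno
    obtain ⟨w, hw, hw'⟩ := hno
    -- A plane containing one pair with difference x + y is invariant under x + y. Failing that, it
    -- is disjoint from its translate, and `C` would hold eight points.
    have hdis : Disjoint R (R.image (· + (x + y))) := by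
      rw [disjoint_left]
      intro a ha ha'
      obtain ⟨b, hb, rfl⟩ := mem_image.1 ha'
      exact hw' (hR.add_mem hb ha hw)
    have hsub : R ∪ R.image (· + (x + y)) ⊆ C := union_subset hRC fun a ha => by
      obtain ⟨b, hb, rfl⟩ := mem_image.1 ha
      exact hd b (hRC hb)
    have := card_le_card hsub
    rw [card_union_of_disjoint hdis, card_image_of_injective _ (add_left_injective _), hR.1] at this
    omega
  · obtain ⟨x, hx, y, hy, hxy⟩ := one_lt_card.1 (by rw [hP.1]; omega : 1 < #P)
    refine ⟨x + y, add_ne_zero_of_ne hxy, fun Q hQC hQ' => ?_⟩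
    obtain rfl : P = Q := by
      by_contra hPQ
      exact hQ ⟨Q, hQC, hQ', hPQ⟩
    exact fun z => hP.add_mem hx (by rwa [add_cancel_two])

variable [Finite V]

theorem AvoidsPlane.isPlane {S : Finset V} {p u v : V} (h : AvoidsPlane S p u v) :
    ∃ P, P = {p, p + u, p + v, p + u + v} ∧ IsPlane P ∧ Disjoint P S := by
  obtain ⟨P, hP, hcard, hd⟩ := h.exists_finset
  refine ⟨P, hP, ⟨hcard, ?_⟩, hd⟩
  rw [hP]
  have hp2 := char_two p
  have hu2 := char_two u
  have hv2 := char_two v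
  simp only [mem_insert, mem_singleton]
  clear hP hcard hd h
  rintro x (rfl | rfl | rfl | rfl) y (rfl | rfl | rfl | rfl) z (rfl | rfl | rfl | rfl) <;>
  grind

theorem card_eq_two_pow_finrank (W : Submodule (ZMod 2) V) :
    Nat.card W = 2 ^ Module.finrank (ZMod 2) W := by
  rw [Module.natCard_eq_pow_finrank (K := ZMod 2), Nat.card_zmod]

theorem card_mul_card_le_inf (F W : Submodule (ZMod 2) V) :
    Nat.card F * Nat.card W ≤ Nat.card V * Nat.card (F ⊓ W : Submodule (ZMod 2) V) := by
  have h := Submodule.finrank_sup_add_finrank_inf_eq F W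
  have h1 := Submodule.finrank_le (F ⊔ W)
  have h2 : Nat.card V = 2 ^ Module.finrank (ZMod 2) V := by
    rw [Module.natCard_eq_pow_finrank (K := ZMod 2), Nat.card_zmod]
  rw [card_eq_two_pow_finrank, card_eq_two_pow_finrank, card_eq_two_pow_finrank, h2, ← pow_add,
    ← pow_add]
  exact Nat.pow_le_pow_right (by norm_num) (by omega)

theorem exists_mem_ne_of_card {U : Submodule (ZMod 2) V} (hU : 2 < Nat.card U) :
    ∃ u ∈ U, ∃ v ∈ U, u ≠ 0 ∧ v ≠ 0 ∧ u ≠ v := by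
  have := Fintype.ofFinite U
  rw [Nat.card_eq_fintype_card, ← card_univ] at hU
  have h1 : 1 < #((univ : Finset U).erase 0) := by
    rw [card_erase_of_mem (mem_univ _)]
    omega
  obtain ⟨u, hu, v, hv, huv⟩ := one_lt_card.1 h1
  rw [mem_erase] at hu hv
  exact ⟨u, u.2, v, v.2, by simpa using hu.1, by simpa using hv.1, by simpa using huv⟩

/-- The vectors of Hamming weight `0`, `3`, `4`. -/
def hexad : Finset (Fin 4 → ZMod 2) := {x | hammingNorm x ≠ 1 ∧ hammingNorm x ≠ 2}

theorem mem_hexad {x : Fin 4 → ZMod 2} :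
    x ∈ hexad ↔ hammingNorm x ≠ 1 ∧ hammingNorm x ≠ 2 := by
  simp [hexad]

theorem card_hexad : #hexad = 6 := by decide

theorem exists_hexad_pair : ∀ x : Fin 4 → ZMod 2, x ≠ 0 → ∃ k ∈ hexad, k + x ∈ hexad := by
  decide

/-- The six vectors sum to zero; the cyclic form leaves any chosen index i as base point. -/
theorem hexad_sum : ∃ κ : Fin 6 → Fin 4 → ZMod 2, Function.Injective κ ∧ (∀ k ∈ hexad, ∃ i, κ i =
    k) ∧
    (∀ i, κ i ∈ hexad) ∧ ∀ i, κ (i + 1) + κ (i + 2) + (κ (i + 3) + κ (i + 4)) = κ (i + 5) + κ i :=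
        by
  refine ⟨![0, 1, ![0, 1, 1, 1], ![1, 0, 1, 1], ![1, 1, 0, 1], ![1, 1, 1, 0]], ?_, ?_, ?_, ?_⟩ <;>
  decide

/-- The subspace F witnessing goodness is not contained in W, so it meets W in at least four
elements, and it also contains some e outside W. Translating F ∩ W by e gives a plane in the other
coset that avoids S. -/
theorem exists_avoidsPlane_of_isGood {S : Finset V} (hV : Nat.card V = 32) {c z : V}
    {f : (Fin 4 → ZMod 2) →ₗ[ZMod 2] V} (hf : Function.Injective f)
    (hS : ∀ x, c + f x ∈ S ↔ x ∈ hexad)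
    (hz : ∀ s, c + s ∉ LinearMap.range f ↔ z + s ∈ LinearMap.range f)
    {k : Fin 4 → ZMod 2} (hk : k ∈ hexad) (hg : IsGood S (c + f k)) :
    ∃ p u v : LinearMap.range f, AvoidsPlane (slice (LinearMap.range f) z S) p u v ∧
      c + f k + u ∉ S ∧ c + f k + v ∉ S ∧ c + f k + u + v ∉ S := by
  obtain ⟨F, hF, hFS⟩ := hg
  set W := LinearMap.range f with hWdef
  have hW : Nat.card W = 16 := card_range_of_injective hf
  have hWF : ∃ e ∈ F, e ∉ W := by
    by_contra! hle
    -- If F ≤ W, then F has index two in W, and the five differences from the base point all lie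
    -- outside F. But four of them sum to the fifth, while a sum of four such elements lies in F.
    have hcard : Nat.card W = 2 * Nat.card (F.comap W.subtype) := by
      rw [Nat.card_congr (Submodule.comapSubtypeEquivOfLe hle).toEquiv, hF, hW]
    obtain ⟨κ, hκ, hsurj, hmem, hsum⟩ := hexad_sum
    obtain ⟨i, rfl⟩ := hsurj k hk
    let w : Fin 6 → W := fun j => ⟨f (κ j + κ i), LinearMap.mem_range_self _ _⟩
    have hw : ∀ j, j ≠ i → w j ∉ F.comap W.subtype := by
      intro j hj hjF
      have h1 : f (κ j + κ i) ∈ F := hjF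
      refine hFS _ h1 ?_ ?_
      · rw [map_ne_zero_iff f hf]
        exact add_ne_zero_of_ne (hκ.ne hj)
      · rw [add_assoc, ← map_add, hS, show κ i + (κ j + κ i) = κ j by grind [char_two (κ i)]]
        exact hmem j
    have hne : ∀ i : Fin 6, i + 1 ≠ i ∧ i + 2 ≠ i ∧ i + 3 ≠ i ∧ i + 4 ≠ i ∧ i + 5 ≠ i := by decide
    obtain ⟨n1, n2, n3, n4, n5⟩ := hne i
    have h12 := add_mem_of_notMem hcard (hw _ n1) (hw _ n2)
    have h34 := add_mem_of_notMem hcard (hw _ n3) (hw _ n4)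
    refine hw _ n5 ?_
    convert Submodule.add_mem _ h12 h34
    apply Subtype.ext
    simp only [w, Submodule.coe_add, ← map_add, ← hsum]
    congr 1
    grind [char_two (κ i)]
  obtain ⟨e, heF, heW⟩ := hWF
  have hinf := card_mul_card_le_inf F W
  rw [hF, hW, hV] at hinf
  obtain ⟨u, hu, v, hv, hu0, hv0, huv⟩ := exists_mem_ne_of_card (U := F ⊓ W) (by omega)
  have huvF := add_mem hu hv
  have hk' : f k ∈ W := LinearMap.mem_range_self _ _
  have hp : z + (c + f k + e) ∈ W := (hz _).1 fun h => heW (by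
    have := W.add_mem h hk'
    rwa [show c + (c + f k + e) + f k = e by grind [char_two c, char_two (f k)]] at this)
  have hout : ∀ t ∈ F ⊓ W, c + f k + e + t ∉ S := by
    intro t ht
    rw [add_assoc (c + f k)]
    refine hFS _ (add_mem heF ht.1) fun h => heW ?_
    rw [show e = t by grind [char_two t]]
    exact ht.2
  refine ⟨⟨_, hp⟩, ⟨u, hu.2⟩, ⟨v, hv.2⟩, ⟨?_, ?_, ?_, ?_, ?_, ?_, ?_⟩, hFS _ hu.1 hu0, hFS _ hv.1
      hv0, ?_⟩
  · simpa using hu0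
  · simpa using hv0
  · simpa using huv
  · simpa [add_cancel_two] using hout 0 (zero_mem _)
  · simpa [add_cancel_two, add_assoc] using hout u hu
  · simpa [add_cancel_two, add_assoc] using hout v hv
  · simpa [add_cancel_two, add_assoc] using hout (u + v) huvF
  · rw [add_assoc (c + f k)]
    exact hFS _ huvF.1 (add_ne_zero_of_ne huv)

theorem weight_le_of_hasPattern {S : Finset V} (hV : Nat.card V = 32) (hS : 16 ≤ #S)
    (h8 : ∀ c ∈ S, spreadNumber S c ≤ 8)
    (hH : ∀ (W : Submodule (ZMod 2) V) (y : V), Nat.card W = 16 → 6 ≤ #{c ∈ S | y + c ∈ W})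
    {c : V} (hp : HasPattern S c) : weight S ≤ 124 := by
  obtain ⟨f, hf, hfS⟩ := hp
  have hW : Nat.card (LinearMap.range f) = 16 := card_range_of_injective hf
  have hVW : Nat.card V = 2 * Nat.card (LinearMap.range f) := by omega
  have hinj : Function.Injective fun x => c + f x := (add_right_injective c).comp hf
  have himage : {s ∈ S | c + s ∈ LinearMap.range f} =
      ({x | c + f x ∈ S} : Finset (Fin 4 → ZMod 2)).image fun x => c + f x := by
    ext s
    simp only [mem_filter, LinearMap.mem_range, mem_image, mem_univ, true_and]
    constructor
    · rintro ⟨hs, x, hx⟩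
      have h : c + f x = s := by rw [hx, add_cancel_two]
      exact ⟨x, h ▸ hs, h⟩
    · rintro ⟨x, hx, rfl⟩
      exact ⟨hx, x, by rw [add_cancel_two]⟩
  have hX : ({x | c + f x ∈ S} : Finset (Fin 4 → ZMod 2)) = hexad := by
    refine eq_of_subset_of_card_le (fun x hx => ?_) ?_
    · rw [mem_hexad, ← not_or]
      exact fun h => hfS x h (mem_filter.1 hx).2
    · have := hH _ c hW
      rwa [himage, card_image_of_injective _ hinj] at this
  have hmem : ∀ x, c + f x ∈ S ↔ x ∈ hexad := fun x => by rw [← hX]; simp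
  rw [hX] at himage
  obtain ⟨z, hz⟩ := exists_coset hVW c
  set T := slice (LinearMap.range f) z S with hT
  have hsum : weight S ≤ ∑ k ∈ hexad, spreadNumber S (c + f k) + 2 * weight T := by
    rw [weight, ← sum_filter_add_sum_filter_not S (fun s => c + s ∈ LinearMap.range f), himage,
      sum_image hinj.injOn]
    simp only [hz]
    have := sum_spreadNumber_coset_le _ hVW z S
    rw [← hT] at this
    omega
  have hcard : #T + 6 = #S := by
    rw [hT, card_slice, ← card_filter_add_card_filter_not (s := S) (fun s => c + s ∈
        LinearMap.range f),
      himage, card_image_of_injective _ hinj, card_hexad]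
    simp only [hz]
    omega
  have h6 : ∀ k, ¬ IsGood S (c + f k) → spreadNumber S (c + f k) ≤ 6 := fun k =>
    spreadNumber_le_six hV (by omega)
  have h48 : ∑ k ∈ hexad, spreadNumber S (c + f k) ≤ 48 := by
    have := sum_le_card_nsmul hexad (fun k => spreadNumber S (c + f k)) 8
      fun k hk => h8 _ ((hmem k).2 hk)
    rwa [card_hexad] at this
  -- The bounds are 48 + 2·32 for #T ≥ 12; 48 + 2·34 or 6·6 + 2·42 for #T = 11; and 2·6 + 4·8 + 2·40
  -- = 124 for #T = 10.
  rcases Nat.lt_or_ge #T 12 with hT12 | hT12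
  swap
  · have := weight_le_thirty_two hW hT12
    omega
  by_cases hT11 : #T = 11
  · by_cases hpl : ∃ p u v, AvoidsPlane T p u v
    · obtain ⟨p, u, v, h⟩ := hpl
      have := weight_le_thirty_four hW hT11 h
      omega
    · have := sum_le_card_nsmul hexad (fun k => spreadNumber S (c + f k)) 6 fun k hk => by
        refine h6 k fun hg => hpl ?_
        obtain ⟨p, u, v, h, -⟩ := exists_avoidsPlane_of_isGood hV hf hmem hz hk hg
        exact ⟨p, u, v, h⟩
      have h42 := weight_le_forty_two (S := T) hW
      rw [card_hexad, smul_eq_mul] at this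
      omega
  · have h40 := weight_le_forty (S := T) hW (by omega)
    have := Fintype.ofFinite (LinearMap.range f)
    have hnt : Nontrivial (LinearMap.range f) := by
      rw [← Finite.one_lt_card_iff_nontrivial]
      omega
    obtain ⟨u, hu0, hu⟩ := exists_common_direction (C := Tᶜ) (by
      rw [card_compl, ← Nat.card_eq_fintype_card]
      omega)
    obtain ⟨x, hx⟩ := u.2
    have hx0 : x ≠ 0 := by
      rintro rfl
      exact hu0 (Subtype.ext (by rw [← hx, map_zero]; rfl))
    obtain ⟨k, hk, hkx⟩ := exists_hexad_pair x hx0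
    -- If the point of `k` were good, its avoided plane would contain the direction u = f x common
    -- to all planes outside T, so c + f (k + x) would not be in S.
    have hbad : ∀ k ∈ hexad, k + x ∈ hexad → spreadNumber S (c + f k) ≤ 6 := by
      intro k hk hkx
      refine h6 k fun hg => ?_
      obtain ⟨p, a, b, h, ha, hb, hab⟩ := exists_avoidsPlane_of_isGood hV hf hmem hz hk hg
      obtain ⟨P, rfl, hP, hd⟩ := h.isPlane
      have h1 := hu _ (le_compl_iff_disjoint_right.2 hd) hP p (by simp)
      have h2 : c + f k + (u : V) ∈ S := by
        rw [← hx, add_assoc, ← map_add]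
        exact (hmem _).2 hkx
      simp only [mem_insert, mem_singleton, add_eq_left, hu0, false_or, add_right_inj, add_assoc]
          at h1
      rcases h1 with rfl | rfl | rfl
      · exact ha h2
      · exact hb h2
      · exact hab (by rwa [add_assoc])
    have hk1 := hbad k hk hkx
    have hk2 := hbad (k + x) hkx (by rwa [add_assoc, char_two, add_zero])
    have hne : k + x ∈ hexad.erase k := mem_erase.2 ⟨by simpa using hx0, hkx⟩
    have h4 := sum_le_card_nsmul ((hexad.erase k).erase (k + x))
      (fun k => spreadNumber S (c + f k)) 8 fun k hk =>
        h8 _ ((hmem k).2 (mem_of_mem_erase (mem_of_mem_erase hk)))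
    rw [card_erase_of_mem hne, card_erase_of_mem hk, card_hexad] at h4
    rw [← add_sum_erase _ _ hk, ← add_sum_erase _ _ hne] at hsum
    simp only [smul_eq_mul] at h4
    omega

end Pattern

/-! ### Directions and reach of three small sets in dimension three -/

section Directions

variable {E : Type*} [AddCommGroup E] [Module (ZMod 2) E]

/-- The differences of distinct elements of `C`. -/
noncomputable def dirs (C : Finset E) : Finset E := ((C ×ˢ C).image fun p => p.1 + p.2).erase 0

theorem mem_dirs {C : Finset E} {u : E} : u ∈ dirs C ↔ u ≠ 0 ∧ ∃ w ∈ C, w + u ∈ C := by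
  simp only [dirs, mem_erase, mem_image, mem_product, Prod.exists]
  refine and_congr_right fun _ => ⟨?_, ?_⟩
  · rintro ⟨a, b, ⟨ha, hb⟩, rfl⟩
    exact ⟨a, ha, by rwa [add_cancel_two]⟩
  · rintro ⟨w, hw, hwu⟩
    exact ⟨w, w + u, ⟨hw, hwu⟩, add_cancel_two w u⟩

/-- The points outside `C` reached from `C` by steps in `U`, together with the sum of `C` if `C`
has three elements. -/
noncomputable def reach (C U : Finset E) : Finset E :=
  ((if #C = 3 then {∑ z ∈ C, z} else ∅) ∪ (C ×ˢ U).image fun p => p.1 + p.2) \ C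

theorem mem_reach_of_mem {C U : Finset E} {v u : E} (hv : v ∉ C) (hu : u ∈ U) (hvu : v + u ∈ C) :
    v ∈ reach C U :=
  mem_sdiff.2 ⟨mem_union_right _ (mem_image.2 ⟨(v + u, u), mem_product.2 ⟨hvu, hu⟩,
    by simp [add_assoc, char_two]⟩), hv⟩

theorem mem_reach_of_plane {C U : Finset E} {v u u' : E} (hC : #C ≤ 3) (hv : v ∉ C) (hu : u ≠ 0)
    (hu' : u' ≠ 0) (huu' : u ≠ u') (h₁ : v + u ∈ C) (h₂ : v + u' ∈ C) (h₃ : v + (u + u') ∈ C) :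
    v ∈ reach C U := by
  have hP : #{v + u, v + u', v + (u + u')} = 3 := by
    refine card_eq_three.2 ⟨_, _, _, ?_, ?_, ?_, rfl⟩ <;> simpa
  have hsub : {v + u, v + u', v + (u + u')} ⊆ C := by
    simp only [insert_subset_iff, singleton_subset_iff]
    exact ⟨h₁, h₂, h₃⟩
  have heq := eq_of_subset_of_card_le hsub (by omega)
  refine mem_sdiff.2 ⟨mem_union_left _ ?_, hv⟩
  rw [← heq, if_pos hP, mem_singleton, sum_insert (by simpa using ⟨huu', hu'⟩),
    sum_insert (by simpa using hu), sum_singleton]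
  grind [char_two v, char_two u, char_two u']

/-- The common differences of `C` and `C'`. -/
noncomputable def commonDirs (C C' : Finset E) : Finset E := dirs C ∩ dirs C'

theorem mem_commonDirs {C C' : Finset E} {u : E} :
    u ∈ commonDirs C C' ↔ u ∈ dirs C ∧ u ∈ dirs C' := mem_inter

theorem card_reach_le (C U : Finset E) : #(reach C U) ≤ 1 + #C * #U := by
  refine (card_le_card sdiff_subset).trans ((card_union_le _ _).trans (add_le_add ?_ ?_))
  · split_ifs <;> simp
  · exact card_image_le.trans (card_product _ _).le

theorem card_reach_add_card_le [Finite E] (C U : Finset E) : #(reach C U) + #C ≤ Nat.card E := by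
  rw [← card_union_of_disjoint (by exact sdiff_disjoint)]
  exact card_le_natCard _

/-- The nonzero elements of a plane through the origin. -/
def IsDirPlane (D : Finset E) : Prop :=
  ∃ a b, a ≠ 0 ∧ b ≠ 0 ∧ a ≠ b ∧ D = {a, b, a + b}

theorem IsDirPlane.card_eq {D : Finset E} (h : IsDirPlane D) : #D = 3 := by
  obtain ⟨a, b, ha, hb, hab, rfl⟩ := h
  exact card_eq_three.2 ⟨_, _, _, hab, by simpa using hb, by simpa using ha, rfl⟩

theorem IsDirPlane.zero_notMem {D : Finset E} (h : IsDirPlane D) : 0 ∉ D := by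
  obtain ⟨a, b, ha, hb, hab, rfl⟩ := h
  simp [ha.symm, hb.symm, (add_ne_zero_of_ne hab).symm]

theorem IsDirPlane.add_mem {D : Finset E} (h : IsDirPlane D) {x y : E} (hx : x ∈ D) (hy : y ∈ D)
    (hxy : x ≠ y) : x + y ∈ D := by
  obtain ⟨a, b, ha, hb, hab, rfl⟩ := h
  have ha2 := char_two a
  have hb2 := char_two b
  simp only [mem_insert, mem_singleton] at hx hy ⊢
  rcases hx with rfl | rfl | rfl <;> rcases hy with rfl | rfl | rfl <;> grind

theorem IsDirPlane.eq_of_one_lt {D D' : Finset E} (h : IsDirPlane D) (h' : IsDirPlane D')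
    (hlt : 1 < #(D ∩ D')) : D = D' := by
  obtain ⟨x, hx, y, hy, hxy⟩ := one_lt_card.1 hlt
  rw [mem_inter] at hx hy
  have key : ∀ R : Finset E, IsDirPlane R → x ∈ R → y ∈ R → {x, y, x + y} = R := by
    intro R hR h1 h2
    have hx0 : x ≠ 0 := fun h0 => hR.zero_notMem (h0 ▸ h1)
    have hy0 : y ≠ 0 := fun h0 => hR.zero_notMem (h0 ▸ h2)
    refine eq_of_subset_of_card_le ?_ ?_
    · simp [insert_subset_iff, h1, h2, hR.add_mem h1 h2 hxy]
    · rw [hR.card_eq, IsDirPlane.card_eq ⟨x, y, hx0, hy0, hxy, rfl⟩]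
  exact (key D h hx.1 hy.1).symm.trans (key D' h' hx.2 hy.2)

theorem dirs_of_card_le_one {C : Finset E} (h : #C ≤ 1) : dirs C = ∅ := by
  rw [eq_empty_iff_forall_notMem]
  intro u hu
  obtain ⟨hu, w, hw, hwu⟩ := mem_dirs.1 hu
  exact hu (by simpa using card_le_one.1 h w hw _ hwu)

theorem dirs_of_card_two {C : Finset E} (h : #C = 2) : #(dirs C) = 1 := by
  obtain ⟨x, y, hxy, rfl⟩ := card_eq_two.1 h
  refine card_eq_one.2 ⟨x + y, ?_⟩
  ext u
  simp only [mem_dirs, mem_insert, mem_singleton, exists_eq_or_imp, exists_eq_left]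
  have hx2 := char_two x
  have hy2 := char_two y
  constructor
  · rintro ⟨hu, (h | h) | (h | h)⟩ <;> grind
  · rintro rfl
    exact ⟨add_ne_zero_of_ne hxy, .inl (.inr (add_cancel_two x y))⟩

theorem dirs_of_card_three {C : Finset E} (h : #C = 3) : IsDirPlane (dirs C) := by
  obtain ⟨x, y, z, hxy, hxz, hyz, rfl⟩ := card_eq_three.1 h
  refine ⟨x + y, x + z, add_ne_zero_of_ne hxy, add_ne_zero_of_ne hxz, by simpa using hyz, ?_⟩
  have hx2 := char_two x
  have hy2 := char_two y
  have hz2 := char_two z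
  ext u
  simp only [mem_dirs, mem_insert, mem_singleton, exists_eq_or_imp, exists_eq_left]
  constructor
  · rintro ⟨hu, (h | h | h) | (h | h | h) | (h | h | h)⟩ <;> grind
  · rintro (rfl | rfl | rfl)
    · exact ⟨add_ne_zero_of_ne hxy, .inl (.inr (.inl (add_cancel_two x y)))⟩
    · exact ⟨add_ne_zero_of_ne hxz, .inl (.inr (.inr (add_cancel_two x z)))⟩
    · exact ⟨add_ne_zero_of_ne (by simpa using hyz), .inr (.inl (.inr (.inr (by grind))))⟩

/-- Both sets lie in a single translate of the four-element plane D ∪ {0}. -/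
theorem card_reach_add_card_le_four {C D : Finset E} (hC : 2 ≤ #C) (hD : IsDirPlane D)
    (hCD : dirs C ⊆ D) : #(reach C D) + #C ≤ 4 := by
  obtain ⟨p, hp⟩ := card_pos.1 (by omega : 0 < #C)
  have hC' : ∀ q ∈ C, q ∈ (insert 0 D).image (p + ·) := by
    intro q hq
    refine mem_image.2 ⟨p + q, ?_, add_cancel_two p q⟩
    by_cases hpq : p = q
    · rw [hpq, char_two]
      exact mem_insert_self _ _
    · exact mem_insert_of_mem (hCD (mem_dirs.2
        ⟨add_ne_zero_of_ne hpq, p, hp, by rwa [add_cancel_two]⟩))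
  have hadd : ∀ x ∈ insert 0 D, ∀ y ∈ insert 0 D, x + y ∈ insert 0 D := by
    intro x hx y hy
    rcases mem_insert.1 hx with rfl | hx'
    · rwa [zero_add]
    rcases mem_insert.1 hy with rfl | hy'
    · rwa [add_zero]
    by_cases hxy : x = y
    · rw [hxy, char_two]
      exact mem_insert_self _ _
    · exact mem_insert_of_mem (hD.add_mem hx' hy' hxy)
  have hsub : reach C D ∪ C ⊆ (insert 0 D).image (p + ·) := by
    refine union_subset (sdiff_subset.trans (union_subset ?_ ?_)) hC'
    · split_ifs with h3
      · rw [singleton_subset_iff]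
        obtain ⟨x, y, z, hxy, hxz, hyz, rfl⟩ := card_eq_three.1 h3
        rw [sum_insert (by simp [hxy, hxz]), sum_insert (by simp [hyz]), sum_singleton]
        obtain ⟨x', hx, rfl⟩ := mem_image.1 (hC' x (by simp))
        obtain ⟨y', hy, rfl⟩ := mem_image.1 (hC' y (by simp))
        obtain ⟨z', hz, rfl⟩ := mem_image.1 (hC' z (by simp))
        exact mem_image.2 ⟨x' + y' + z', hadd _ (hadd _ hx _ hy) _ hz, by grind [char_two p]⟩
      · simp
    · intro w hw
      obtain ⟨⟨q, u⟩, hqu, rfl⟩ := mem_image.1 hw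
      obtain ⟨hq, hu⟩ := mem_product.1 hqu
      obtain ⟨q', hq', h⟩ := mem_image.1 (hC' q hq)
      refine mem_image.2 ⟨q' + u, hadd _ hq' _ (mem_insert_of_mem hu), ?_⟩
      simp only at h ⊢
      rw [← h, add_assoc]
  have := card_le_card hsub
  rwa [card_union_of_disjoint (by exact sdiff_disjoint),
    card_image_of_injective _ (add_right_injective p), card_insert_of_notMem hD.zero_notMem,
    hD.card_eq] at this

theorem isDirPlane_of_card_dirs {C : Finset E} (hC : #C ≤ 3) (h : 1 < #(dirs C)) :
    #C = 3 ∧ IsDirPlane (dirs C) := by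
  have h3 : #C = 3 := by
    by_contra h3
    rcases Nat.lt_or_ge 1 #C with h1 | h1
    · have := dirs_of_card_two (by omega : #C = 2)
      omega
    · simp [dirs_of_card_le_one h1] at h
  exact ⟨h3, dirs_of_card_three h3⟩

variable [Finite E]

/-- C₂ and C₃ must be triples with the same direction plane D. Either C₁ has at least two points and
directions inside D, and its reach stays in a plane; or it shares at most one direction with D, and
the other two reaches are small. -/
theorem sum_card_reach_le_of_one_lt (hE : Nat.card E = 8) {C₁ C₂ C₃ : Finset E} (h₁ : #C₁ ≤ 3)
    (h₂ : #C₂ ≤ 3) (h₃ : #C₃ ≤ 3) (hlt : 1 < #(dirs C₂ ∩ dirs C₃)) :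
    #(reach C₁ (dirs C₂ ∩ dirs C₃)) + #(reach C₂ (dirs C₁ ∩ dirs C₃)) +
      #(reach C₃ (dirs C₁ ∩ dirs C₂)) ≤ 5 + #C₁ + #C₂ + #C₃ := by
  obtain ⟨c₂, hD⟩ := isDirPlane_of_card_dirs h₂ (hlt.trans_le (card_le_card inter_subset_left))
  obtain ⟨c₃, hD'⟩ := isDirPlane_of_card_dirs h₃ (hlt.trans_le (card_le_card inter_subset_right))
  have hDD := hD.eq_of_one_lt hD' hlt
  rw [← hDD, inter_self] at *
  have a₁ := card_reach_add_card_le C₁ (dirs C₂)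
  have a₂ := card_reach_add_card_le C₂ (dirs C₁ ∩ dirs C₂)
  have a₃ := card_reach_add_card_le C₃ (dirs C₁ ∩ dirs C₂)
  have b₂ := card_reach_le C₂ (dirs C₁ ∩ dirs C₂)
  have b₃ := card_reach_le C₃ (dirs C₁ ∩ dirs C₂)
  rw [c₂] at b₂
  rw [c₃] at b₃
  have hU : #(dirs C₁ ∩ dirs C₂) ≤ #(dirs C₁) := card_le_card inter_subset_left
  by_cases hsub : 2 ≤ #C₁ ∧ dirs C₁ ⊆ dirs C₂
  · have := card_reach_add_card_le_four hsub.1 hD hsub.2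
    rcases Nat.lt_or_ge #C₁ 3 with h | h
    · have := dirs_of_card_two (by omega : #C₁ = 2)
      omega
    · omega
  · rcases Nat.lt_or_ge #C₁ 2 with h | h
    · have h0 := congrArg card (dirs_of_card_le_one (by omega : #C₁ ≤ 1))
      rw [card_empty] at h0
      rw [Nat.le_zero.1 (hU.trans h0.le)] at b₂ b₃
      omega
    · have hsub' : ¬ dirs C₁ ⊆ dirs C₂ := fun h' => hsub ⟨h, h'⟩
      rcases Nat.lt_or_ge #C₁ 3 with h' | h'
      · have h1 := dirs_of_card_two (by omega : #C₁ = 2)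
        have : #(dirs C₁ ∩ dirs C₂) ≠ 1 := fun h0 =>
          hsub' (inter_eq_left.1 (eq_of_subset_of_card_le inter_subset_left (by omega)))
        omega
      · have : ¬ 1 < #(dirs C₁ ∩ dirs C₂) := fun h0 =>
          hsub' ((dirs_of_card_three (by omega)).eq_of_one_lt hD h0).subset
        omega

theorem sum_card_reach_le (hE : Nat.card E = 8) {C₁ C₂ C₃ : Finset E} (h₁ : #C₁ ≤ 3)
    (h₂ : #C₂ ≤ 3) (h₃ : #C₃ ≤ 3) :
    #(reach C₁ (commonDirs C₂ C₃)) + #(reach C₂ (commonDirs C₁ C₃)) +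
      #(reach C₃ (commonDirs C₁ C₂)) ≤ 5 + #C₁ + #C₂ + #C₃ := by
  unfold commonDirs
  by_cases u₁ : 1 < #(dirs C₂ ∩ dirs C₃)
  · exact sum_card_reach_le_of_one_lt hE h₁ h₂ h₃ u₁
  by_cases u₂ : 1 < #(dirs C₁ ∩ dirs C₃)
  · have := sum_card_reach_le_of_one_lt hE h₂ h₁ h₃ u₂
    rw [inter_comm (dirs C₂) (dirs C₁)] at this
    omega
  by_cases u₃ : 1 < #(dirs C₁ ∩ dirs C₂)
  · have := sum_card_reach_le_of_one_lt hE h₃ h₁ h₂ u₃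
    rw [inter_comm (dirs C₃) (dirs C₁), inter_comm (dirs C₃) (dirs C₂)] at this
    omega
  have b₁ := card_reach_le C₁ (dirs C₂ ∩ dirs C₃)
  have b₂ := card_reach_le C₂ (dirs C₁ ∩ dirs C₃)
  have b₃ := card_reach_le C₃ (dirs C₁ ∩ dirs C₂)
  have := Nat.mul_le_mul_left #C₁ (not_lt.1 u₁)
  have := Nat.mul_le_mul_left #C₂ (not_lt.1 u₂)
  have := Nat.mul_le_mul_left #C₃ (not_lt.1 u₃)
  omega

end Directions

/-! ### Counting good points and the bound 124 -/

section Main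

variable {V : Type*} [AddCommGroup V] [Module (ZMod 2) V] [Finite V]

/-- The complement of `slice F x S` in `F`. -/
noncomputable def coslice (F : Submodule (ZMod 2) V) (x : V) (S : Finset V) : Finset F :=
  haveI := Fintype.ofFinite F
  (slice F x S)ᶜ

theorem mem_coslice {F : Submodule (ZMod 2) V} {x : V} {S : Finset V} {v : F} :
    v ∈ coslice F x S ↔ x + (v : V) ∉ S := by
  let := Fintype.ofFinite F
  rw [← mem_slice]
  exact mem_compl

theorem card_slice_add_card_coslice (F : Submodule (ZMod 2) V) (x : V) (S : Finset V) :
    #(slice F x S) + #(coslice F x S) = Nat.card F := by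
  let := Fintype.ofFinite F
  rw [Nat.card_eq_fintype_card, ← card_add_card_compl (slice F x S)]
  unfold coslice
  congr!

/-- Let F' witness goodness. If F' ∩ F has more than two elements, three points of the coslice
complete v to a plane. If it is {0, u}, then F' + F = V, so the translate of F' meets every coset of
F in a pair with difference u, and u is a direction of both other coslices. -/
theorem mem_reach_of_isGood {S : Finset V} (hV : Nat.card V = 32) {F : Submodule (ZMod 2) V}
    (hF : Nat.card F = 8) {g x y z : V} {v : F} (hs : g + x + v ∈ S)
    (hgood : IsGood S (g + x + v)) (hC : #(coslice F (g + x) S) ≤ 3) (hy : x + y ∉ F)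
    (hz : x + z ∉ F) :
    v ∈ reach (coslice F (g + x) S)
      (commonDirs (coslice F (g + y) S) (coslice F (g + z) S)) := by
  obtain ⟨F', hF', hFS⟩ := hgood
  have hv : v ∉ coslice F (g + x) S := fun h => mem_coslice.1 h hs
  have hmem : ∀ u : F, (u : V) ∈ F' → u ≠ 0 → v + u ∈ coslice F (g + x) S := by
    intro u hu hu0
    rw [mem_coslice, Submodule.coe_add, ← add_assoc]
    exact hFS _ hu (by simpa using hu0)
  have hinf := card_mul_card_le_inf F' F
  rw [hF, hF', hV] at hinf
  by_cases h2 : 2 < Nat.card (F' ⊓ F : Submodule (ZMod 2) V)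
  · obtain ⟨u, hu, u', hu', hu0, hu0', huu'⟩ := exists_mem_ne_of_card h2
    lift u to F using hu.2
    lift u' to F using hu'.2
    simp only [ne_eq, ZeroMemClass.coe_eq_zero, SetLike.coe_eq_coe] at hu0 hu0' huu'
    exact mem_reach_of_plane hC hv hu0 hu0' huu' (hmem _ hu.1 hu0) (hmem _ hu'.1 hu0')
      (hmem _ (F'.add_mem hu.1 hu'.1) (add_ne_zero_of_ne huu'))
  · have hcard : Nat.card (F' ⊓ F : Submodule (ZMod 2) V) = 2 := by omega
    have hsup : F' ⊔ F = ⊤ := by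
      have h := Submodule.finrank_sup_add_finrank_inf_eq F' F
      have hpow : ∀ {a b : ℕ}, 2 ^ a = 2 ^ b → a = b := fun h => Nat.pow_right_injective le_rfl h
      rw [card_eq_two_pow_finrank] at hF hF' hcard
      rw [Module.natCard_eq_pow_finrank (K := ZMod 2), Nat.card_zmod] at hV
      have e1 := hpow (hF.trans (by norm_num : 8 = 2 ^ 3))
      have e2 := hpow (hF'.trans (by norm_num : 8 = 2 ^ 3))
      have e3 := hpow (hcard.trans (by norm_num : 2 = 2 ^ 1))
      have e4 := hpow (hV.trans (by norm_num : 32 = 2 ^ 5))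
      exact Submodule.eq_top_of_finrank_eq (by omega)
    obtain ⟨u, hu, hu0⟩ : ∃ u ∈ F' ⊓ F, u ≠ 0 := by
      have := Submodule.exists_mem_ne_zero_of_ne_bot (p := F' ⊓ F) (by
        intro h
        rw [h] at hcard
        simp at hcard)
      exact this
    lift u to F using hu.2
    rw [ne_eq, ZeroMemClass.coe_eq_zero] at hu0
    have hdir : ∀ y, x + y ∉ F → u ∈ dirs (coslice F (g + y) S) := by
      intro y hy
      obtain ⟨e, he, h, hh, heh⟩ := Submodule.mem_sup.1 (hsup ▸ Submodule.mem_top : x + y ∈ F' ⊔ F)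
      have heF : e ∉ F := fun h' => hy (heh ▸ F.add_mem h' hh)
      refine mem_dirs.2 ⟨hu0, v + ⟨h, hh⟩, ?_, ?_⟩
      · rw [mem_coslice]
        have := hFS e he (fun h0 => heF (h0 ▸ F.zero_mem))
        rwa [show g + x + v + e = g + y + (v + h) by grind [char_two x, char_two h]] at this
      · rw [mem_coslice]
        have := hFS (e + u) (F'.add_mem he hu.1) (fun h0 => heF (by
          rw [show e = u by grind [char_two (u : V)]]
          exact u.2))
        rwa [show g + x + v + (e + u) = g + y + (v + h + u) by
          grind [char_two x, char_two h]] at this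
    exact mem_reach_of_mem hv (mem_commonDirs.2 ⟨hdir y hy, hdir z hz⟩) (hmem u hu.1 hu0)

theorem exists_submodule_insert {F : Submodule (ZMod 2) V} {y : V} (hy : y ∉ F) :
    ∃ W : Submodule (ZMod 2) V, Nat.card W = 2 * Nat.card F ∧ ∀ x, x ∈ W ↔ x ∈ F ∨ y + x ∈ F := by
  have hmem : ∀ x, x ∈ F ⊔ Submodule.span (ZMod 2) {y} ↔ x ∈ F ∨ y + x ∈ F := by
    intro x
    rw [Submodule.mem_sup]
    constructor
    · rintro ⟨f, hf, z, hz, rfl⟩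
      obtain ⟨e, rfl⟩ := Submodule.mem_span_singleton.1 hz
      rcases smul_cases e y with ⟨-, h⟩ | ⟨-, h⟩ <;> rw [h]
      · exact .inl (by rwa [add_zero])
      · exact .inr (by rwa [add_comm f, add_cancel_two])
    · rintro (h | h)
      · exact ⟨x, h, 0, zero_mem _, add_zero x⟩
      · exact ⟨y + x, h, y, Submodule.mem_span_singleton_self y, by
          grind [char_two y]⟩
  refine ⟨F ⊔ Submodule.span (ZMod 2) {y}, ?_, hmem⟩
  have h1 : F < F ⊔ Submodule.span (ZMod 2) {y} :=
    lt_of_le_of_ne le_sup_left fun h => hy (by rw [h, hmem, char_two]; exact .inr F.zero_mem)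
  have h2 := Submodule.finrank_lt_finrank_of_lt h1
  have h3 := Submodule.finrank_add_le_finrank_add_finrank F (Submodule.span (ZMod 2) {y})
  have h4 := finrank_span_singleton (K := ZMod 2) (v := y) (fun h => hy (h ▸ F.zero_mem))
  rw [card_eq_two_pow_finrank, card_eq_two_pow_finrank,
    (by omega : Module.finrank (ZMod 2) (F ⊔ Submodule.span (ZMod 2) {y} : Submodule (ZMod 2) V) =
      Module.finrank (ZMod 2) F + 1), pow_succ, mul_comm]

/-- Cut V into the four cosets of the F witnessing that g is good. The coset of g holds at most one
point of S; by the hyperplane hypothesis each other coset misses at most three points, so the reach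
estimates apply. -/
theorem card_add_card_isGood_le {S : Finset V} (hV : Nat.card V = 32)
    (hH : ∀ (W : Submodule (ZMod 2) V) (y : V), Nat.card W = 16 → 6 ≤ #{c ∈ S | y + c ∈ W})
    {g : V} (hg : IsGood S g) : #S + #{c ∈ S | IsGood S c} ≤ 31 := by
  obtain ⟨F, hF, hFS⟩ := hg
  have hlt : ∀ W : Submodule (ZMod 2) V, Nat.card W < 32 → ∃ y, y ∉ W := by
    intro W hW
    by_contra! h
    have h1 : Nat.card (⊤ : Submodule (ZMod 2) V) = Nat.card V :=
      Nat.card_congr Submodule.topEquiv.toEquiv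
    rw [Submodule.eq_top_iff'.2 h] at hW
    omega
  have hsplit : ∀ s, g + s ∈ F → s ∈ S → s = g := by
    intro s hs hsS
    by_contra hne
    exact hFS _ hs (add_ne_zero_of_ne (Ne.symm hne)) (by rwa [add_cancel_two])
  have hA₀ : #{s ∈ S | g + s ∈ F} ≤ 1 := by
    refine card_le_one.2 fun a ha b hb => ?_
    rw [mem_filter] at ha hb
    rw [hsplit a ha.2 ha.1, hsplit b hb.2 hb.1]
  have hc : ∀ y, y ∉ F → #(coslice F (g + y) S) ≤ 3 := by
    intro y hy
    obtain ⟨W, hW, hmem⟩ := exists_submodule_insert hy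
    have h6 := hH W g (by omega)
    have h1 := card_slice_add_card_coslice F (g + y) S
    have h2 : #{c ∈ S | g + c ∈ W} ≤ #{c ∈ S | g + c ∈ F} + #(slice F (g + y) S) := by
      rw [card_slice]
      refine le_trans (card_le_card fun c hc => ?_) (card_union_le _ _)
      simp only [mem_filter, mem_union, hmem] at hc ⊢
      rw [show g + y + c = y + (g + c) by abel]
      tauto
    omega
  have hgoodle : ∀ x y z, x ∉ F → x + y ∉ F → x + z ∉ F →
      #{s ∈ {s ∈ S | IsGood S s} | g + x + s ∈ F} ≤ #(reach (coslice F (g + x) S)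
        (commonDirs (coslice F (g + y) S) (coslice F (g + z) S))) := by
    intro x y z hx hy hz
    rw [← card_slice]
    refine card_le_card fun v hv => ?_
    rw [mem_slice, mem_filter] at hv
    exact mem_reach_of_isGood hV hF hv.1 hv.2 (hc x hx) hy hz
  obtain ⟨x, hx⟩ := hlt F (by omega)
  obtain ⟨W, hW, hmem⟩ := exists_submodule_insert hx
  obtain ⟨y, hy⟩ := hlt W (by omega)
  obtain ⟨hy, hxy⟩ := not_or.1 (mt (hmem y).2 hy)
  have hcover : ∀ T : Finset V, #T ≤ #{s ∈ T | g + s ∈ F} + #{s ∈ T | g + x + s ∈ F} +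
      #{s ∈ T | g + y + s ∈ F} + #{s ∈ T | g + (x + y) + s ∈ F} := by
    intro T
    refine le_trans (card_le_card (t := {s ∈ T | g + s ∈ F} ∪ {s ∈ T | g + x + s ∈ F} ∪
      {s ∈ T | g + y + s ∈ F} ∪ {s ∈ T | g + (x + y) + s ∈ F}) fun s hs => ?_) ?_
    · have h1 := hmem (g + s)
      have h2 := hmem (y + (g + s))
      have h3 : ¬ (g + s ∈ W) → y + (g + s) ∈ W :=
        add_mem_of_notMem (by omega) (by rw [hmem]; tauto)
      rw [show x + (g + s) = g + x + s by abel] at h1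
      rw [show x + (y + (g + s)) = g + (x + y) + s by abel,
        show y + (g + s) = g + y + s by abel] at h2
      rw [show y + (g + s) = g + y + s by abel] at h3
      simp only [mem_union, mem_filter, hs, true_and]
      tauto
    · refine (card_union_le _ _).trans (Nat.add_le_add_right ?_ _)
      refine (card_union_le _ _).trans (Nat.add_le_add_right ?_ _)
      exact card_union_le _ _
  have hS := hcover S
  have hG := hcover {s ∈ S | IsGood S s}
  have hG₀ : #{s ∈ {s ∈ S | IsGood S s} | g + s ∈ F} ≤ 1 :=
    (card_le_card (filter_subset_filter _ (filter_subset _ _))).trans hA₀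
  have hyx : y + x ∉ F := by rwa [add_comm]
  have g₁ := hgoodle x y (x + y) hx hxy (by rwa [add_cancel_two])
  have g₂ := hgoodle y x (x + y) hy hyx (by rwa [add_comm x y, add_cancel_two])
  have g₃ := hgoodle (x + y) x y hxy (by rwa [add_comm, add_cancel_two])
    (by rwa [add_assoc, char_two, add_zero])
  have s₁ := card_slice_add_card_coslice F (g + x) S
  have s₂ := card_slice_add_card_coslice F (g + y) S
  have s₃ := card_slice_add_card_coslice F (g + (x + y)) S
  -- With m the number of points missing from the three cosets, #S ≤ 1 + 24 − m and the good points
  -- number at most 1 + 5 + m.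
  have := sum_card_reach_le hF (hc x hx) (hc y hy) (hc _ hxy)
  rw [card_slice] at s₁ s₂ s₃
  omega

theorem weight_le_one_hundred_twenty_four {S : Finset V} (hV : Nat.card V = 32) :
    weight S ≤ 124 := by
  by_cases hiso : ∃ c ∈ S, IsIsolated S c
  · obtain ⟨c, hc, h⟩ := hiso
    exact weight_le_of_isIsolated hV hc h
  push Not at hiso
  have h10 : ∀ c ∈ S, spreadNumber S c ≤ 8 ∨ spreadNumber S c ≤ 10 ∧ #S ≤ 11 :=
    fun c hc => spreadNumber_le_eight hV hc (hiso c hc)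
  rcases Nat.lt_or_ge #S 12 with h12 | h12
  · have := weight_le_card_mul (S := S) (k := 10) fun c hc => by
      have := h10 c hc
      omega
    omega
  have h8 : ∀ c ∈ S, spreadNumber S c ≤ 8 := fun c hc => by
    have := h10 c hc
    omega
  rcases Nat.lt_or_ge #S 16 with h16 | h16
  · have := weight_le_card_mul h8
    omega
  by_cases hH : ∃ (W : Submodule (ZMod 2) V) (y : V), Nat.card W = 16 ∧ #{c ∈ S | y + c ∈ W} ≤ 5
  · obtain ⟨W, y, hW, h5⟩ := hH
    exact weight_le_of_card_coset_le hV h8 hW y h5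
  have hH' : ∀ (W : Submodule (ZMod 2) V) (y : V), Nat.card W = 16 → 6 ≤ #{c ∈ S | y + c ∈ W} :=
    fun W y hW => by
      by_contra h
      exact hH ⟨W, y, hW, by omega⟩
  by_cases hp : ∃ c, HasPattern S c
  · obtain ⟨c, hp⟩ := hp
    exact weight_le_of_hasPattern hV h16 h8 hH' hp
  have h4 : ∀ c ∈ S, spreadNumber S c ≤ 4 + if IsGood S c then 4 else 0 := by
    intro c hc
    split_ifs with hg
    · exact h8 c hc
    · obtain ⟨A, hA, hcard⟩ := exists_isSpread S c
      by_contra! hlt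
      exact hp ⟨c, hasPattern_of_spread hA hg (by omega)⟩
  have hle : weight S ≤ 4 * #S + 4 * #{c ∈ S | IsGood S c} := by
    refine (sum_le_sum h4).trans ?_
    rw [sum_add_distrib, ← sum_filter]
    simp [mul_comm]
  by_cases hg : ∃ g, IsGood S g
  · obtain ⟨g, hg⟩ := hg
    have := card_add_card_isGood_le hV hH' hg
    omega
  · have h0 : #{c ∈ S | IsGood S c} = 0 := by
      rw [card_eq_zero, filter_eq_empty_iff]
      exact fun c _ h => hg ⟨c, h⟩
    have h1 := card_le_natCard S
    -- Without good points 4·#S suffices unless S is everything, when every spread has at most one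
    -- element.
    by_cases h32 : #S = 32
    · obtain ⟨c, hc⟩ := card_pos.1 (by omega : 0 < #S)
      have hle1 := weight_le_card_mul (S := S) (k := 1) fun c hc => by
        obtain ⟨A, hA, hcard⟩ := exists_isSpread S c
        rw [← hcard]
        by_contra! hlt
        obtain ⟨a, ha, b, hb, hab⟩ := one_lt_card.1 hlt
        have := Fintype.ofFinite V
        have huniv : S = univ := by
          rw [← card_eq_iff_eq_univ, h32, ← Nat.card_eq_fintype_card, hV]
        exact hA ha hb hab (huniv ▸ mem_univ _)
      omega
    · omega

end Main

end Weight

/-! ### Passage between ℤ_4^n and weights; constructions for the lower bounds -/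

section Bridge

/-- The residue modulo `4` with binary digits `c`, `a`. -/
def ofDigits (c a : ZMod 2) : ZMod 4 := (c.val + 2 * a.val : ℕ)

/-- The vector over `ℤ/4ℤ` with reduction `c` modulo `2` and second digits `a`. -/
def point {n : ℕ} (c a : Fin n → ZMod 2) : Fin n → ZMod 4 := fun i => ofDigits (c i) (a i)

variable {n : ℕ}

theorem exists_point (x : Fin n → ZMod 4) : ∃ c a, point c a = x := by
  have h : ∀ x : ZMod 4, ∃ p : ZMod 2 × ZMod 2, ofDigits p.1 p.2 = x := by decide
  choose p hp using h
  exact ⟨fun i => (p (x i)).1, fun i => (p (x i)).2, funext fun i => hp (x i)⟩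

theorem point_right_injective (c : Fin n → ZMod 2) : Function.Injective (point c) := by
  intro a b h
  have key : ∀ c a b, ofDigits c a = ofDigits c b → a = b := by decide
  exact funext fun i => key _ _ _ (congrFun h i)

theorem eq_of_point_eq {c a c' a' : Fin n → ZMod 2} (h : point c a = point c' a') : c = c' := by
  have key : ∀ c a c' a', ofDigits c a = ofDigits c' a' → c = c' := by decide
  exact funext fun i => key _ _ _ _ (congrFun h i)

theorem point_add_point (c a b e : Fin n → ZMod 2) (h : c + a + b = e) (f : Fin n → ZMod 2) :
    point c a + point c b = point e f + point e f := by
  have key : ∀ c a b f, ofDigits c a + ofDigits c b =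
      ofDigits (c + a + b) f + ofDigits (c + a + b) f := by decide
  subst h
  exact funext fun i => key _ _ _ _

theorem eq_of_point_add_point {c a c' b e f : Fin n → ZMod 2}
    (h : point c a + point c' b = point e f + point e f) : c = c' ∧ c + a + b = e := by
  have key : ∀ c a c' b e f, ofDigits c a + ofDigits c' b = ofDigits e f + ofDigits e f →
      c = c' ∧ c + a + b = e := by decide
  exact ⟨funext fun i => (key _ _ _ _ _ _ (congrFun h i)).1,
    funext fun i => (key _ _ _ _ _ _ (congrFun h i)).2⟩

theorem isProperAP_of_add_eq {G : Type*} [AddCommGroup G] {x y z : G} (hxz : x ≠ z)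
    (h : x + z = y + y) : IsProperAP 3 ![x, y, z] := by
  have hxy : x ≠ y := by
    rintro rfl
    exact hxz (add_left_cancel h).symm
  have hyz : y ≠ z := by
    rintro rfl
    exact hxz (add_right_cancel h)
  refine ⟨?_, x, y - x, ?_⟩
  · intro i j hij
    fin_cases i <;> fin_cases j <;> simp_all
  · intro i
    fin_cases i
    · simp
    · simp
    · simp only [two_nsmul, Fin.reduceFinMk, Matrix.cons_val]
      rw [show x + (y - x + (y - x)) = y + y - x by abel, ← h, add_sub_cancel_left]

theorem add_eq_of_isProperAP {G : Type*} [AddCommGroup G] {x : Fin 3 → G} (h : IsProperAP 3 x) :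
    x 0 + x 2 = x 1 + x 1 ∧ x 0 ≠ x 2 := by
  obtain ⟨hinj, a, d, hx⟩ := h
  refine ⟨?_, hinj.ne (by decide)⟩
  rw [hx, hx, hx]
  simp only [Fin.isValue, Fin.val_zero, Fin.val_one, Fin.val_two, zero_smul, one_smul, two_smul]
  abel

/-- The fibre of A over c is a spread at c: any point of A over c + a + b would be the midpoint of
the points with second digits a and b. -/
theorem maxAPFree_le {w : ℕ} (h : ∀ S : Finset (Fin n → ZMod 2), weight S ≤ w) :
    maxAPFree 3 4 n ≤ w := by
  classical
  refine Finset.sup_le fun A hA => ?_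
  have hA := (mem_filter.1 hA).2
  let B : (Fin n → ZMod 2) → Finset (Fin n → ZMod 2) := fun c => {a | point c a ∈ A}
  let S : Finset (Fin n → ZMod 2) := {c | (B c).Nonempty}
  have hB : ∀ {c a}, a ∈ B c ↔ point c a ∈ A := by simp [B]
  have hsub : A ⊆ S.biUnion fun c => (B c).image (point c) := by
    intro x hx
    obtain ⟨c, a, rfl⟩ := exists_point x
    exact mem_biUnion.2 ⟨c, mem_filter.2 ⟨mem_univ _, a, hB.2 hx⟩, mem_image_of_mem _ (hB.2 hx)⟩
  have hspread : ∀ c, IsSpread S c (B c) := by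
    intro c a ha b hb hab he
    obtain ⟨f, hf⟩ := (mem_filter.1 he).2
    refine hA ⟨_, isProperAP_of_add_eq ((point_right_injective c).ne hab)
      (point_add_point c a b _ rfl f), fun i => ?_⟩
    fin_cases i
    · exact hB.1 ha
    · exact hB.1 hf
    · exact hB.1 hb
  calc #A ≤ #(S.biUnion fun c => (B c).image (point c)) := card_le_card hsub
    _ ≤ ∑ c ∈ S, #((B c).image (point c)) := card_biUnion_le
    _ ≤ ∑ c ∈ S, spreadNumber S c :=
      sum_le_sum fun c _ => card_image_le.trans (hspread c).card_le
    _ ≤ w := h S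

/-- A family of codes, one for each point of `S`, yields a progression-free set. -/
theorem sum_card_le_maxAPFree (S : Finset (Fin n → ZMod 2))
    (M : (Fin n → ZMod 2) → (Fin n → ZMod 2) → Prop) [DecidableRel M]
    (hadd : ∀ c a b, M c a → M c b → M c (a + b))
    (hsep : ∀ c ∈ S, ∀ d, d ≠ 0 → M c d → c + d ∉ S) :
    ∑ c ∈ S, #{a | M c a} ≤ maxAPFree 3 4 n := by
  classical
  let T : Finset (Fin n → ZMod 4) := S.biUnion fun c => ({a | M c a} : Finset _).image (point c)
  have hT : ∀ {x}, x ∈ T → ∃ c ∈ S, ∃ a, M c a ∧ point c a = x := by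
    intro x hx
    obtain ⟨c, hc, hx⟩ := mem_biUnion.1 hx
    obtain ⟨a, ha, rfl⟩ := mem_image.1 hx
    exact ⟨c, hc, a, (mem_filter.1 ha).2, rfl⟩
  have hcard : #T = ∑ c ∈ S, #{a | M c a} := by
    rw [card_biUnion]
    · exact sum_congr rfl fun c _ => card_image_of_injective _ (point_right_injective c)
    · intro c _ c' _ hcc'
      rw [Function.onFun, disjoint_left]
      intro x hx hx'
      obtain ⟨a, -, rfl⟩ := mem_image.1 hx
      obtain ⟨a', -, h⟩ := mem_image.1 hx'
      exact hcc' (eq_of_point_eq h).symm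
  have hfree : IsAPFree 3 T := by
    rintro ⟨x, hx, hxT⟩
    obtain ⟨hsum, hne⟩ := add_eq_of_isProperAP hx
    obtain ⟨c, hc, a, ha, h0⟩ := hT (hxT 0)
    obtain ⟨c', -, b, hb, h2⟩ := hT (hxT 2)
    obtain ⟨e, he, f, -, h1⟩ := hT (hxT 1)
    rw [← h0, ← h1, ← h2] at hsum
    obtain ⟨rfl, rfl⟩ := eq_of_point_add_point hsum
    refine hsep c hc (a + b) (add_ne_zero_of_ne ?_) (hadd c a b ha hb) ?_
    · rintro rfl
      exact hne (h0.symm.trans h2)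
    · rwa [← add_assoc]
  rw [← hcard]
  exact le_sup (f := Finset.card) (mem_filter.2 ⟨mem_univ T, hfree⟩)

/-- The linear codes attached to the points of Hamming weight at most one. -/
def codeOne (c d : Fin n → ZMod 2) : Prop :=
  (∀ i, c i * d i = 0) ∧ (c = 0 → ∑ i, d i = 0)

instance : DecidableRel (codeOne (n := n)) := fun c d =>
  inferInstanceAs (Decidable ((∀ i, c i * d i = 0) ∧ (c = 0 → ∑ i, d i = 0)))

theorem codeOne_add (c a b : Fin n → ZMod 2) (ha : codeOne c a) (hb : codeOne c b) :
    codeOne c (a + b) :=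
  ⟨fun i => by rw [Pi.add_apply, mul_add, ha.1, hb.1, add_zero],
    fun hc => by simp only [Pi.add_apply, sum_add_distrib, ha.2 hc, hb.2 hc, add_zero]⟩

/-- The linear codes attached to the points of Hamming weight at most two; `P` is the code
attached to the origin. -/
def codeTwo (P : (Fin n → ZMod 2) → Prop) (c d : Fin n → ZMod 2) : Prop :=
  (∀ i, c i * d i = 0) ∧ (hammingNorm c = 1 → ∑ i, d i = 0) ∧ (c = 0 → P d)

instance (P : (Fin n → ZMod 2) → Prop) [DecidablePred P] : DecidableRel (codeTwo P) := fun c d =>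
  inferInstanceAs (Decidable ((∀ i, c i * d i = 0) ∧ (hammingNorm c = 1 → ∑ i, d i = 0) ∧
    (c = 0 → P d)))

theorem codeTwo_add {P : (Fin n → ZMod 2) → Prop} (hP : ∀ a b, P a → P b → P (a + b))
    (c a b : Fin n → ZMod 2) (ha : codeTwo P c a) (hb : codeTwo P c b) : codeTwo P c (a + b) :=
  ⟨fun i => by rw [Pi.add_apply, mul_add, ha.1, hb.1, add_zero],
    fun hc => by simp only [Pi.add_apply, sum_add_distrib, ha.2.1 hc, hb.2.1 hc, add_zero],
    fun hc => hP a b (ha.2.2 hc) (hb.2.2 hc)⟩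

theorem two_le_maxAPFree : 2 ≤ maxAPFree 3 4 1 :=
  le_trans (by decide) (sum_card_le_maxAPFree {c | hammingNorm c ≤ 1} codeOne codeOne_add
    (by decide))

theorem six_le_maxAPFree : 6 ≤ maxAPFree 3 4 2 :=
  le_trans (by decide) (sum_card_le_maxAPFree {c | hammingNorm c ≤ 1} codeOne codeOne_add
    (by decide))

theorem sixteen_le_maxAPFree : 16 ≤ maxAPFree 3 4 3 :=
  le_trans (by decide) (sum_card_le_maxAPFree {c | hammingNorm c ≤ 1} codeOne codeOne_add
    (by decide))

/-- The code at the origin is {0000, 1110}, of minimum distance 3. Weights two, one and zero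
contribute 6·4 + 4·4 + 2. -/
theorem forty_two_le_maxAPFree : 42 ≤ maxAPFree 3 4 4 :=
  le_trans (by decide +kernel) (sum_card_le_maxAPFree {c | hammingNorm c ≤ 2}
    (codeTwo fun d => d 0 = d 1 ∧ d 1 = d 2 ∧ d 3 = 0)
    (codeTwo_add fun a b ha hb => by simp [ha, hb]) (by decide +kernel))

/-- The code at the origin is {00000, 11100, 00111, 11011}, of minimum distance 3. The count is 10·8
+ 5·8 + 4. -/
theorem one_hundred_twenty_four_le_maxAPFree : 124 ≤ maxAPFree 3 4 5 :=
  le_trans (by decide +kernel) (sum_card_le_maxAPFree {c | hammingNorm c ≤ 2}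
    (codeTwo fun d => d 0 = d 1 ∧ d 3 = d 4 ∧ d 2 = d 0 + d 3)
    (codeTwo_add fun a b ha hb => by simp [ha, hb, add_add_add_comm]) (by decide +kernel))

end Bridge

end ProgressionFree

open ProgressionFree

theorem mainTheorem1 :
    maxAPFree 3 4 1 = 2 ∧ maxAPFree 3 4 2 = 6 ∧ maxAPFree 3 4 3 = 16 ∧
      maxAPFree 3 4 4 = 42 ∧ maxAPFree 3 4 5 = 124 := by
  have hV : ∀ n, Nat.card (Fin n → ZMod 2) = 2 ^ n := fun n => by simp
  exact ⟨(maxAPFree_le fun _ => weight_le_two (hV 1)).antisymm two_le_maxAPFree,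
    (maxAPFree_le fun _ => weight_le_six (hV 2)).antisymm six_le_maxAPFree,
    (maxAPFree_le fun _ => weight_le_sixteen (hV 3)).antisymm sixteen_le_maxAPFree,
    (maxAPFree_le fun _ => weight_le_forty_two (hV 4)).antisymm forty_two_le_maxAPFree,
    (maxAPFree_le fun _ => weight_le_one_hundred_twenty_four (hV 5)).antisymm
      one_hundred_twenty_four_le_maxAPFree⟩
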